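/- **Proposition (the PT chain on permutations).** Let $N\ge 1$. *Permutation tableaux.* A partition $\lambda=(\lambda_1\ge\dots\ge\lambda_t\ge 0)$ (rows of length $0$ are allowed) has half-perimeter $t+\lambda_1$. A permutation tableau of shape $\lambda$ is a filling of the Young diagram of $\lambda$ with $0$'s and $1$'s such that every column contains a $1$ and no $0$ has both a $1$ above it in its column and a $1$ to its left in its row. Let $\mathcal{PT}_{N+1}$ be the set of permutation tableaux of half-perimeter $N+1$. Label the unit steps of the south-east border of the diagram, from north-east to south-west, by $1,\dots,N+1$; the south steps label the rows and the west steps label the columns. A $1$ is *superfluous* if there is another $1$ above it in its column, and *necessary* if it is the only $1$ in its column. *The map $\Phi$.* Draw from every $1$ of $\mathcal T$ an edge to the east and an edge to the south, each leading to the closest $1$ in the same row or column, or else to the border label of that row or column. For a row label $i$, go west to the leftmost $1$ of the row, then zig-zag, at first to the south, turning at every $1$ that is met; $\Phi(\mathcal T)(i)$ is the label at which the path ends (and $\Phi(\mathcal T)(i)=i$ if the row has no $1$). For a column label $i$, go north to the topmost $1$ of the column, then zig-zag in the same way, at first to the east; $\Phi(\mathcal T)(i)$ is the label at which the path ends. *The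 PT chain.* For real $\alpha,\beta,q$ it is given by the following transitions $\mathcal S\to\mathcal T$ on $\mathcal{PT}_{N+1}$, where $\mathcal S$ has shape $(\lambda_1,\dots,\lambda_t)$ and $\lambda_{t+1}:=0$. New rows are inserted as far south, and new columns as far east, as the shape permits. - (enter; probability $\frac{\alpha}{N+1}$) If the rightmost column has length $1$: delete it and insert an all-zero row of length $\lambda_1-1$. - (hop right; $\frac{1}{N+1}$) If $2\le j\le t$ and $\lambda_j>\lambda_{j+1}$: if the last entry of row $j$ is $0$, delete row $j$ and insert an all-zero row of length $\lambda_j-1$; if it is a superfluous $1$, remove its box; if it is a necessary $1$, delete its column and insert a column of length one less, with a $1$ at the bottom and $0$'s elsewhere. - (exit; $\frac{\beta}{N+1}$) If $\lambda_t=0$: delete row $t$ and insert a column of length $t-1$ with a $1$ at the bottom and $0$'s elsewhere. - (hop left; $\frac{q}{N+1}$) If $j<t$ and $\lambda_j>\lambda_{j+1}$: lengthen row $j+1$ by one box, filled with a $1$. All other probabilities of moving to a different state are $0$, and the probability of staying at $\mathcal S$ is $1$ minus the sum of the probabilities of leaving $\mathcal S$. *Permutations.* A *weak excedance* of $\pi$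 is an $i$ with $\pi(i)\ge i$, a *non-excedance* an $i$ with $\pi(i)<i$. The *collapse* of a permutation $\pi$ of a set $S$ at $i\in S$ is the permutation of $S\setminus\{i\}$ that sends $\pi^{-1}(i)$ to $\pi(i)$ and agrees with $\pi$ elsewhere (if $\pi(i)=i$, it is the restriction of $\pi$). The *normalization* $\mathrm{Norm}(\sigma)$ of a permutation $\sigma$ of $\{s_1<\dots<s_n\}$ is the permutation of $\{1,\dots,n\}$ obtained by replacing each $s_k$ by $k$. **Claim.** The map $\Phi$ is a bijection from $\mathcal{PT}_{N+1}$ to $S_{N+1}$. For all real $\alpha,\beta,q$, it carries the PT chain to the chain on $S_{N+1}$ with transition probabilities $P$ given as follows (for $\pi\in S_{N+1}$; the "next non-excedance after $m$" is the smallest non-excedance of $\pi$ that is greater than $m$, or $N+2$ if there is none). - *Particle enters from the left.* Suppose $\pi(2)=1$. Let $i+1$ be the next non-excedance after $2$, and let $\sigma$ be the permutation of $(\{1,\dots,N+1\}\setminus\{2\})\cup\{i+\frac12\}$ obtained by collapsing $\pi$ at $2$ and adding the fixed point $i+\frac12$. Then $P(\pi\to\mathrm{Norm}(\sigma))=\frac{\alpha}{N+1}$.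 - *Particle hops right.* Suppose $2\le i\le N$, $\pi(i)\ge i$ and $\pi(i+1)<i+1$. Then $P(\pi\to\mathrm{Norm}(\sigma))=\frac1{N+1}$ for the following $\sigma$. - If $\pi(i)=i$: let $j+1$ be the next non-excedance after $i+1$; $\sigma$ is the permutation of $(\{1,\dots,N+1\}\setminus\{i\})\cup\{j+\frac12\}$ obtained by collapsing $\pi$ at $i$ and adding the fixed point $j+\frac12$. - If $\pi(i)>i$ and $\pi(i+1)<i$: $\sigma(i)=\pi(i+1)$, $\sigma(i+1)=\pi(i)$, and $\sigma(k)=\pi(k)$ for $k\ne i,i+1$. - If $\pi(i)>i$ and $\pi(i+1)=i$: let $j$ be the greatest weak excedance of $\pi$ less than $i$; $\sigma$ is the permutation of $(\{1,\dots,N+1\}\setminus\{i+1\})\cup\{j+\frac12\}$ obtained by collapsing $\pi$ at $i+1$ and then, where $b$ is the element that the collapsed permutation sends to $j$, setting $\sigma(b)=j+\frac12$ and $\sigma(j+\frac12)=j$. - *Particle exits to the right.* Suppose $\pi(N+1)=N+1$. Let $i$ be the greatest weak excedance of $\pi$ less than $N+1$, and let $\sigma$ be the permutation of $\{1,\dots,N\}\cup\{i+\frac12\}$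 obtained by collapsing $\pi$ at $N+1$ and then, where $a=\pi^{-1}(i)$, setting $\sigma(a)=i+\frac12$ and $\sigma(i+\frac12)=i$. Then $P(\pi\to\mathrm{Norm}(\sigma))=\frac{\beta}{N+1}$. - *Particle hops left.* Suppose $\pi(i)<i$ and $\pi(i+1)\ge i+1$, and let $\sigma(i)=\pi(i+1)$, $\sigma(i+1)=\pi(i)$, and $\sigma(k)=\pi(k)$ for $k\ne i,i+1$. Then $P(\pi\to\sigma)=\frac{q}{N+1}$. - $P(\pi\to\tau)=0$ for every other $\tau\ne\pi$, and $P(\pi\to\pi)=1-\sum_{\tau\ne\pi}P(\pi\to\tau)$. If moreover $0\le\alpha,\beta,q\le1$, then $P$ is a stochastic matrix, so that this is a Markov chain on $S_{N+1}$. -/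

import Mathlib

open Equiv

/-! ### Permutation tableaux -/

/-- A permutation tableau of half-perimeter `n`.

A Young diagram of half-perimeter `n` (rows of length `0` allowed) is identified with the lattice
path of `n` unit steps south and west that goes along its border from the north-east corner to the
south-west corner. The steps are labelled, from north-east to south-west, by the elements of
`Fin n` (the element `k` standing for the label `k + 1`). The rows of the diagram are named by the
labels of the south steps, from top to bottom, and the columns by the labels of the west steps,
from right to left. So row `i` and column `j` meet in a box exactly when `i < j`;
row `i'` lies above row `i` iff `i' < i`, and column `j'` lies to the left of column `j` iff
`j < j'`. -/
@[ext]
structure PermutationTableau (n : ℕ) where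
  /-- `south k` says whether step `k` of the border path goes south (otherwise it goes west). -/
  south : Fin n → Bool
  /-- `one i j` says that row `i` and column `j` meet in a box, and that it is filled with a `1`;
  all other boxes are filled with a `0`. -/
  one : Fin n → Fin n → Bool
  /-- The border path begins with a step south. -/
  south_first : ∀ k : Fin n, k.val = 0 → south k = true
  /-- The `1`s stand in boxes of the diagram. -/
  box_of_one : ∀ i j, one i j = true → south i = true ∧ south j = false ∧ i < j
  /-- Each column contains at least one `1`. -/
  exists_one : ∀ j, south j = false → ∃ i, one i j = true
  /-- No `0` has a `1` above it in its column and a `1` to its left in its row. -/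
  no_bad_zero : ∀ i j, south i = true → south j = false → i < j → one i j = false →
    ¬ ((∃ i', i' < i ∧ one i' j = true) ∧ (∃ j', j < j' ∧ one i j' = true))

namespace PermutationTableau

variable {n N : ℕ}

noncomputable instance : Fintype (PermutationTableau n) :=
  Fintype.ofInjective
    (fun T : PermutationTableau n => ((T.south, T.one) : (Fin n → Bool) × (Fin n → Fin n → Bool)))
    (fun S T h => by
      have h' := Prod.mk.inj h
      exact PermutationTableau.ext h'.1 h'.2)

/-- Step `k` is the label of a row. -/
def IsRow (T : PermutationTableau n) (k : Fin n) : Prop := T.south k = true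

/-- Step `k` is the label of a column. -/
def IsCol (T : PermutationTableau n) (k : Fin n) : Prop := T.south k = false

/-- The length (number of boxes) of row `i`. -/
def rowLen (T : PermutationTableau n) (i : Fin n) : ℕ :=
  (Finset.univ.filter fun j => T.south j = false ∧ i < j).card

/-- The length (number of boxes) of column `j`. -/
def colLen (T : PermutationTableau n) (j : Fin n) : ℕ :=
  (Finset.univ.filter fun i => T.south i = true ∧ i < j).card

/-- The number of rows (those of length `0` included). -/
def numRows (T : PermutationTableau n) : ℕ :=
  (Finset.univ.filter fun i => T.south i = true).card

/-- The number of columns, which is the length of the top row. -/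
def numCols (T : PermutationTableau n) : ℕ :=
  (Finset.univ.filter fun j => T.south j = false).card

/-! ### The bijection to permutations -/

/-- The two directions in which the edges of the diagram of a tableau are travelled. -/
inductive Direction
  | south
  | east

/-- `T.ZigzagFrom d i j k`: in the diagram of `T`, whose vertices are the `1`s, the path that leaves
the vertex in row `i` and column `j` in direction `d`, and from then on travels south and east and
turns at every vertex it meets, terminates at the border label `k`. An edge to the south leads to
the closest vertex below in the same column and, if there is none, to the label of the column; an
edge to the east leads to the closest vertex to the right in the same row and, if there is none, to
the label of the row. -/
inductive ZigzagFrom (T : PermutationTableau n) : Direction → Fin n → Fin n → Fin n → Prop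
  | south_exit (i j : Fin n) (h : ∀ i', i < i' → T.one i' j = false) :
      ZigzagFrom T Direction.south i j j
  | south_turn (i i' j k : Fin n) (hi : i < i') (h1 : T.one i' j = true)
      (h0 : ∀ i'', i < i'' → i'' < i' → T.one i'' j = false)
      (h : ZigzagFrom T Direction.east i' j k) :
      ZigzagFrom T Direction.south i j k
  | east_exit (i j : Fin n) (h : ∀ j', j' < j → T.one i j' = false) :
      ZigzagFrom T Direction.east i j i
  | east_turn (i j j' k : Fin n) (hj : j' < j) (h1 : T.one i j' = true)
      (h0 : ∀ j'', j' < j'' → j'' < j → T.one i j'' = false)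
      (h : ZigzagFrom T Direction.south i j' k) :
      ZigzagFrom T Direction.east i j k

/-- `T.ZigzagEnd x k`: the path of the label `x` in the diagram of `T` ends at the label `k`.
If `x` labels a row without `1`s, then `k = x`. If `x` labels a row that has a `1`, the path goes
west to the leftmost `1` of that row, and then zig-zags, at first to the south. If `x` labels a
column, it goes north to the topmost `1` of that column, and then zig-zags, at first to the east. -/
inductive ZigzagEnd (T : PermutationTableau n) : Fin n → Fin n → Prop
  | zero_row (i : Fin n) (hi : T.IsRow i) (h : ∀ j, T.one i j = false) : ZigzagEnd T i i
  | row (i j k : Fin n) (hi : T.IsRow i) (h1 : T.one i j = true)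
      (h0 : ∀ j', j < j' → T.one i j' = false) (h : T.ZigzagFrom Direction.south i j k) :
      ZigzagEnd T i k
  | col (i j k : Fin n) (hj : T.IsCol j) (h1 : T.one i j = true)
      (h0 : ∀ i', i' < i → T.one i' j = false) (h : T.ZigzagFrom Direction.east i j k) :
      ZigzagEnd T j k

/-! ### The PT chain -/

/-- Deleting the line (row or column) labelled `p` from `S` leaves the same filled diagram as
deleting the line labelled `r` from `T`; that is, `T` arises from `S` by deleting the line `p` and
inserting a new line, which is labelled `r` in `T`. -/
def ReplaceLine (S T : PermutationTableau (N + 1)) (p r : Fin (N + 1)) : Prop :=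
  (∀ k : Fin N, T.south (r.succAbove k) = S.south (p.succAbove k)) ∧
  ∀ k l : Fin N, T.one (r.succAbove k) (r.succAbove l) = S.one (p.succAbove k) (p.succAbove l)

/-- `r` labels an all-zero row of `T` of length `ℓ`, and this row stands as far south as the weak
decrease of the row lengths permits: every row below it is strictly shorter. -/
def IsNewRow (T : PermutationTableau n) (r : Fin n) (ℓ : ℕ) : Prop :=
  T.IsRow r ∧ T.rowLen r = ℓ ∧ (∀ j, T.one r j = false) ∧
  ∀ i, r < i → T.IsRow i → T.rowLen i < T.rowLen r

/-- `r` labels a column of `T` of length `ℓ` whose bottom entry is a `1` and whose other entries are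
`0`s, and this column stands as far east as possible: every column to its right is strictly
shorter. -/
def IsNewCol (T : PermutationTableau n) (r : Fin n) (ℓ : ℕ) : Prop :=
  T.IsCol r ∧ T.colLen r = ℓ ∧
  (∀ i, T.one i r = true ↔ T.IsRow i ∧ i < r ∧ ∀ i', i < i' → i' < r → ¬ T.IsRow i') ∧
  ∀ j, j < r → T.IsCol j → T.colLen j < T.colLen r

/-- The labels `i`, `i'` are consecutive; in `S` they belong to a column followed by a row (an inner
corner of the diagram), and `T` arises from `S` by adding one box to the end of that row and filling
it with a `1`. In `T` the row has the label `i` and the column has the label `i'`. -/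
def AddCorner (S T : PermutationTableau n) (i i' : Fin n) : Prop :=
  i'.val = i.val + 1 ∧ S.IsCol i ∧ S.IsRow i' ∧
  (∀ k, T.south k = S.south (swap i i' k)) ∧
  ∀ k l, T.one k l = true ↔ (k = i ∧ l = i') ∨ S.one (swap i i' k) (swap i i' l) = true

/-- Particle enters from the left: the rightmost column `p` has length `1`; it is deleted, and an
all-zero row, one shorter than the top row of `S`, is inserted as far south as possible. -/
def EntersLeft (S T : PermutationTableau (N + 1)) : Prop :=
  ∃ p r : Fin (N + 1), S.IsCol p ∧ (∀ j, S.IsCol j → p ≤ j) ∧ S.colLen p = 1 ∧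
    S.ReplaceLine T p r ∧ T.IsNewRow r (S.numCols - 1)

/-- Particle hops right, for the row `i`, which is not the top row and which is strictly longer than
the next row (or is the last row and not empty). So `i` is followed on the border path by a column
`i'`, and the rightmost entry of row `i` is the one in column `i'`. -/
def HopsRight (S T : PermutationTableau (N + 1)) : Prop :=
  ∃ i i' : Fin (N + 1), 1 ≤ i.val ∧ i'.val = i.val + 1 ∧ S.IsRow i ∧ S.IsCol i' ∧
    ( ( -- the rightmost entry is a `0`: the row `i` is replaced by a shorter row of `0`s
      S.one i i' = false ∧
        ∃ r, S.ReplaceLine T i r ∧ T.IsNewRow r (S.rowLen i - 1)) ∨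
     ( -- the rightmost entry is a superfluous `1`: its box is removed
      S.one i i' = true ∧ (∃ k, k < i ∧ S.one k i' = true) ∧ T.AddCorner S i i') ∨
     ( -- the rightmost entry is a necessary `1`: its column is replaced by a shorter column
      S.one i i' = true ∧ (∀ k, S.one k i' = true → k = i) ∧
        ∃ r, S.ReplaceLine T i' r ∧ T.IsNewCol r (S.colLen i' - 1)))

/-- Particle exits to the right: the last row `p` has length `0`; it is deleted, and a column with
a `1` at the bottom and `0`s elsewhere, as long as there are rows left, is inserted as far to the
right as possible. -/
def ExitsRight (S T : PermutationTableau (N + 1)) : Prop :=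
  ∃ p r : Fin (N + 1), S.IsRow p ∧ (∀ i, S.IsRow i → i ≤ p) ∧ S.rowLen p = 0 ∧
    S.ReplaceLine T p r ∧ T.IsNewCol r (S.numRows - 1)

/-- Particle hops left: a row that is strictly shorter than the row above it is made longer by one
box, which is filled with a `1`. -/
def HopsLeft (S T : PermutationTableau (N + 1)) : Prop :=
  ∃ i i' : Fin (N + 1), S.AddCorner T i i'

open Classical in
/-- The probability of the transition from `S` to `T ≠ S` in the PT chain. -/
noncomputable def moveProb (α β q : ℝ) (S T : PermutationTableau (N + 1)) : ℝ :=
  if S.EntersLeft T then α / (N + 1)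
  else if S.HopsRight T then 1 / (N + 1)
  else if S.ExitsRight T then β / (N + 1)
  else if S.HopsLeft T then q / (N + 1)
  else 0

open Classical in
/-- The transition matrix of the PT chain on the permutation tableaux of half-perimeter `N + 1`. -/
noncomputable def ptChain (N : ℕ) (α β q : ℝ) :
    Matrix (PermutationTableau (N + 1)) (PermutationTableau (N + 1)) ℝ :=
  Matrix.of fun S T =>
    if S = T then 1 - ∑ U ∈ Finset.univ.erase S, moveProb α β q S U else moveProb α β q S T

end PermutationTableau

/-! ### Permutations of finite ordered sets -/

namespace PermChain

variable {n N : ℕ} {S : Finset ℚ}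

/-- The collapse at `i` of a permutation `π` of `S`: the permutation of `S \ {i}` that sends `π⁻¹ i`
to `π i` and agrees with `π` elsewhere (if `π` fixes `i`, it is just the restriction of `π`).
Here `Perm.ofSubtype` extends `π` by the identity. -/
def collapse (π : Perm S) (i : ℚ) : Perm (S.erase i) :=
  (swap i (Perm.ofSubtype π i) * Perm.ofSubtype π).subtypePerm (by
    have key : ∀ x, Perm.ofSubtype π x ∈ S ↔ x ∈ S := fun x => by
      by_cases hx : x ∈ S
      · rw [Perm.ofSubtype_apply_of_mem π hx]; simp [hx]
      · rw [Perm.ofSubtype_apply_of_not_mem π hx]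
    intro x
    simp only [Finset.mem_erase, Perm.coe_mul, Function.comp_apply]
    rcases eq_or_ne x i with rfl | hx
    · simp
    · have h2 : Perm.ofSubtype π x ≠ Perm.ofSubtype π i := fun h => hx (Equiv.injective _ h)
      rcases eq_or_ne (Perm.ofSubtype π x) i with h | h
      · rw [h, swap_apply_left, key]
        have := key x
        rw [h] at this
        rw [h] at h2
        exact ⟨fun h' => ⟨hx, this.1 h'.2⟩, fun h' => ⟨h2.symm, this.2 h'.2⟩⟩
      · rw [swap_apply_of_ne_of_ne h h2, key]
        simp [hx, h])

/-- The permutation of `S ∪ {a}` that arises from a permutation of `S` by adding the fixed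
point `a`. -/
def addFixedPoint (σ : Perm S) (a : ℚ) : Perm (insert a S : Finset ℚ) :=
  (Perm.ofSubtype σ).subtypePerm (by
    intro x
    by_cases hx : x ∈ S
    · rw [Perm.ofSubtype_apply_of_mem σ hx]; simp [hx]
    · rw [Perm.ofSubtype_apply_of_not_mem σ hx])

/-- The permutation `σ'` of `S ∪ {a}` that arises from a permutation `σ` of `S` (where `a ∉ S`) by
replacing `σ b = i` by `σ' b = a` and `σ' a = i`. -/
def insertBefore (σ : Perm S) (a : ℚ) (i : S) : Perm (insert a S : Finset ℚ) :=
  (addFixedPoint σ a).trans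
    (swap ⟨a, Finset.mem_insert_self a S⟩ ⟨i, Finset.mem_insert_of_mem i.2⟩)

/-- The normalization of a permutation of `S = {s₁ < ⋯ < sₙ}`, which replaces each `sᵢ` by `i`. -/
def norm (h : S.card = n) (σ : Perm S) : Perm (Fin n) :=
  (S.orderIsoOfFin h).symm.toEquiv.permCongr σ

/-- The label in `{1, …, n}` of an element of `Fin n`. -/
def lab (x : Fin n) : ℚ := x.val + 1

/-- The set `{1, …, n}`. -/
def labels (n : ℕ) : Finset ℚ := Finset.univ.image (lab : Fin n → ℚ)

theorem lab_injective : Function.Injective (lab : Fin n → ℚ) := fun x y h => by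
  simpa [lab, Fin.ext_iff] using h

theorem lab_mem (x : Fin n) : lab x ∈ labels n := Finset.mem_image_of_mem _ (Finset.mem_univ x)

theorem card_labels : (labels n).card = n := by
  rw [labels, Finset.card_image_of_injective _ lab_injective, Finset.card_univ, Fintype.card_fin]

theorem half_notMem (m : ℕ) : (m + 1 / 2 : ℚ) ∉ labels n := by
  intro h
  obtain ⟨x, -, hx⟩ := Finset.mem_image.1 h
  have h2 : ((2 * (x.val + 1) : ℕ) : ℚ) = ((2 * m + 1 : ℕ) : ℚ) := by
    push_cast
    simp only [lab] at hx
    linarith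
  have h3 : 2 * (x.val + 1) = 2 * m + 1 := by exact_mod_cast h2
  omega

/-- The set `({1, …, n} \ {p}) ∪ {m + 1/2}` has `n` elements. -/
theorem card_replace (p : Fin n) (m : ℕ) :
    (insert (m + 1 / 2 : ℚ) ((labels n).erase (lab p))).card = n := by
  rw [Finset.card_insert_of_notMem fun h => half_notMem m (Finset.mem_of_mem_erase h),
    Finset.card_erase_of_mem (lab_mem p), card_labels]
  have := p.pos
  omega

/-- A permutation of `Fin n` as a permutation of the set `{1, …, n}` of labels. -/
def onLabels (π : Perm (Fin n)) : Perm (labels n) :=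
  ((labels n).orderIsoOfFin card_labels).toEquiv.permCongr π

/-- `π` is collapsed at `p`, a fixed point is added at `m + 1/2`, and the result is normalized. -/
def collapseAddFixed (π : Perm (Fin n)) (p : Fin n) (m : ℕ) : Perm (Fin n) :=
  norm (card_replace p m) (addFixedPoint (collapse (onLabels π) (lab p)) (m + 1 / 2))

/-- `π` is collapsed at `p`; in the permutation `σ` thus obtained, with `m` the label of `j ≠ p`,
`σ b = m` is replaced by `σ b = m + 1/2` and `σ (m + 1/2) = m`; and the result is normalized. -/
def collapseInsertBefore (π : Perm (Fin n)) (p j : Fin n) (h : j ≠ p) : Perm (Fin n) :=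
  norm (card_replace p (j.val + 1))
    (insertBefore (collapse (onLabels π) (lab p)) ((j.val + 1 : ℕ) + 1 / 2)
      ⟨lab j, Finset.mem_erase.2 ⟨fun e => h (lab_injective e), lab_mem j⟩⟩)

/-! ### The moves on permutations -/

/-- `x` is a weak excedance of `π`. -/
def IsWeakExc (π : Perm (Fin n)) (x : Fin n) : Prop := x ≤ π x

/-- `x` is a non-excedance of `π`. -/
def IsNonexc (π : Perm (Fin n)) (x : Fin n) : Prop := π x < x

/-- `k` is the smallest number greater than `m` that is (the label of) a non-excedance of `π`, and
`k = n + 1` if there is none. -/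
def IsNextNonexc (π : Perm (Fin n)) (m k : ℕ) : Prop :=
  IsLeast (insert (n + 1) {k | m < k ∧ ∃ x : Fin n, x.val + 1 = k ∧ IsNonexc π x}) k

/-- `j` is the greatest weak excedance of `π` that is less than `x`. -/
def IsPrevWeakExc (π : Perm (Fin n)) (x j : Fin n) : Prop :=
  IsGreatest {j | j < x ∧ IsWeakExc π j} j

/-- Particle enters from the left: `π 2 = 1`, and, with `i + 1` the next non-excedance after `2`,
`π` is collapsed at `2` and a fixed point is added at `i + 1/2`. -/
def EntersLeft (π τ : Perm (Fin (N + 1))) : Prop :=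
  ∃ p : Fin (N + 1), p.val + 1 = 2 ∧ (π p).val + 1 = 1 ∧
    ∃ i : ℕ, IsNextNonexc π 2 (i + 1) ∧ τ = collapseAddFixed π p i

/-- Particle hops right: `i ≥ 2` and `i' = i + 1` with `π i ≥ i` and `π i' < i'`. -/
def HopsRight (π τ : Perm (Fin (N + 1))) : Prop :=
  ∃ i i' : Fin (N + 1), 2 ≤ i.val + 1 ∧ i'.val = i.val + 1 ∧ i ≤ π i ∧ π i' < i' ∧
    ( ( -- `π i = i`: collapse at `i`, and add a fixed point just before the next non-excedance
      -- `m + 1`, where `m > i`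
      π i = i ∧ ∃ m : ℕ, IsNextNonexc π (i'.val + 1) (m + 1) ∧ τ = collapseAddFixed π i m) ∨
     ( -- `π i > i` and `π (i + 1) < i`: the values at `i` and `i + 1` are swapped
      i < π i ∧ π i' < i ∧ τ = π * swap i i') ∨
     ( -- `π i > i` and `π (i + 1) = i`: collapse at `i + 1`, and insert `j + 1/2` before `j`
      i < π i ∧ π i' = i ∧ ∃ (j : Fin (N + 1)) (h : j ≠ i'), IsPrevWeakExc π i j ∧
        τ = collapseInsertBefore π i' j h))

/-- Particle exits to the right: `π (N + 1) = N + 1`; collapse at `N + 1`, and insert `i + 1/2`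
before the greatest weak excedance `i < N + 1`. -/
def ExitsRight (π τ : Perm (Fin (N + 1))) : Prop :=
  π (Fin.last N) = Fin.last N ∧
    ∃ (i : Fin (N + 1)) (h : i ≠ Fin.last N), IsPrevWeakExc π (Fin.last N) i ∧
      τ = collapseInsertBefore π (Fin.last N) i h

/-- Particle hops left: `π i < i` and `π (i + 1) ≥ i + 1`; the values at `i`, `i + 1` are
swapped. -/
def HopsLeft (π τ : Perm (Fin (N + 1))) : Prop :=
  ∃ i i' : Fin (N + 1), i'.val = i.val + 1 ∧ π i < i ∧ i' ≤ π i' ∧ τ = π * swap i i'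

end PermChain

namespace PermutationTableau

variable {n N : ℕ}

/-! ### Zig-zag paths -/

/-! Three local operations build every tableau from one without columns, and `Φ` turns each into an
elementary operation on permutations. Inserting an all-zero row labelled `r` adds the fixed point
`r`. Inserting, directly after row `i` on the border, a column `r` whose only `1` lies in row `i`
sends `r` to `i` and substitutes `r` for the former value `i`. Appending a box with a `1` at an
inner corner between consecutive labels `i`, `i'` multiplies the permutation on the right by the
transposition of `i` and `i'`. In each case the paths change only next to the new line or box
(`IsDeletion.zigzagEnd_zeroRow`, `IsDeletion.zigzagEnd_necessaryCorner`, `AddCorner.zigzagEnd`).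

Conversely, let a row `i` be followed on the border by a column `i'`. The box where they meet is a
`0`, and then the whole row is zero; or a necessary `1`; or a superfluous `1` (`corner_cases`). In
each case one of the operations can be undone, which gives the induction principle `induction_on`
and, through it, that `Φ` is a well-defined permutation. The rows are the weak excedances, and the
three cases read `Φ i = i`, `Φ i' = i`, and `Φ i > i` with `Φ i' < i`. So `Φ` reveals which
operation to undo, whence injectivity; the same trichotomy at a descent from a weak excedance to a
non-excedance gives surjectivity.

The moves of the chain are made of these operations. Deleting the line in question collapses the
permutation at its label, and inserting a line adds a fixed point or a label before a weak
excedance. "As far south" and "as far east" fix the position of the new line by its length, and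
counting rows and columns identifies it with the next non-excedance or the previous weak excedance
(`IsDeletion.newRow_iff`, `IsDeletion.newCol_iff`).

The four kinds of moves exclude each other, because the number of rows and the sum of the column
labels change differently. Each of the `N + 1` positions admits at most one move, so for parameters
in `[0, 1]` the probabilities of leaving a state add up to at most `1`. -/

theorem ZigzagFrom.unique {T : PermutationTableau n} {d : Direction} {i j k k' : Fin n}
    (h : T.ZigzagFrom d i j k) (h' : T.ZigzagFrom d i j k') : k = k' := by
  induction h generalizing k' with
  | south_exit i j h =>
    cases h' with
    | south_exit => rfl
    | south_turn _ i' _ _ hi h1 => simp [h i' hi] at h1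
  | south_turn i i' j k hi h1 h0 _ ih =>
    cases h' with
    | south_exit _ _ h => simp [h i' hi] at h1
    | south_turn _ i₂ _ _ hi₂ h1₂ h0₂ h₂ =>
      have : i' = i₂ := by
        rcases lt_trichotomy i' i₂ with h | h | h
        · simp [h0₂ i' hi h] at h1
        · exact h
        · simp [h0 i₂ hi₂ h] at h1₂
      subst this
      exact ih h₂
  | east_exit i j h =>
    cases h' with
    | east_exit => rfl
    | east_turn _ _ j' _ hj h1 => simp [h j' hj] at h1
  | east_turn i j j' k hj h1 h0 _ ih =>
    cases h' with
    | east_exit _ _ h => simp [h j' hj] at h1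
    | east_turn _ _ j₂ _ hj₂ h1₂ h0₂ h₂ =>
      have : j' = j₂ := by
        rcases lt_trichotomy j' j₂ with h | h | h
        · simp [h0 j₂ h hj₂] at h1₂
        · exact h
        · simp [h0₂ j' h hj] at h1
      subst this
      exact ih h₂

theorem IsRow.not_isCol {T : PermutationTableau n} {k : Fin n} (h : T.IsRow k) : ¬ T.IsCol k := by
  simp_all [IsRow, IsCol]

theorem not_isRow {T : PermutationTableau n} {k : Fin n} : ¬ T.IsRow k ↔ T.IsCol k := by
  simp [IsRow, IsCol]

theorem isRow_of_one {T : PermutationTableau n} {i j : Fin n} (h : T.one i j = true) :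
    T.IsRow i := (T.box_of_one i j h).1

theorem isCol_of_one {T : PermutationTableau n} {i j : Fin n} (h : T.one i j = true) :
    T.IsCol j := (T.box_of_one i j h).2.1

theorem lt_of_one {T : PermutationTableau n} {i j : Fin n} (h : T.one i j = true) :
    i < j := (T.box_of_one i j h).2.2

theorem ZigzagEnd.unique {T : PermutationTableau n} {x k k' : Fin n}
    (h : T.ZigzagEnd x k) (h' : T.ZigzagEnd x k') : k = k' := by
  cases h with
  | zero_row _ hi h =>
    cases h' with
    | zero_row => rfl
    | row _ j _ _ h1 => simp [h j] at h1
    | col _ _ _ hj => exact absurd hj hi.not_isCol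
  | row _ j _ hi h1 h0 h =>
    cases h' with
    | zero_row _ _ h => simp [h j] at h1
    | row _ j₂ _ _ h1₂ h0₂ h₂ =>
      have : j = j₂ := by
        rcases lt_trichotomy j j₂ with h | h | h
        · simp [h0 _ h] at h1₂
        · exact h
        · simp [h0₂ _ h] at h1
      subst this
      exact h.unique h₂
    | col _ _ _ hj => exact absurd hj hi.not_isCol
  | col i _ _ hj h1 h0 h =>
    cases h' with
    | zero_row _ hi => exact absurd hj hi.not_isCol
    | row _ _ _ hi => exact absurd hj hi.not_isCol
    | col i₂ _ _ _ h1₂ h0₂ h₂ =>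
      have : i = i₂ := by
        rcases lt_trichotomy i i₂ with h | h | h
        · simp [h0₂ _ h] at h1
        · exact h
        · simp [h0 _ h] at h1₂
      subst this
      exact h.unique h₂

/-- Steps south increase the row label and steps east decrease the column label, while row < column
at every `1`; so the end stays between the two starting labels. The strict clauses, one for each
initial direction, separate excedances from fixed points and from non-excedances. -/
theorem ZigzagFrom.bounds {T : PermutationTableau n} {d : Direction} {i j k : Fin n}
    (h : T.ZigzagFrom d i j k) (hij : i < j) :
    i ≤ k ∧ k ≤ j ∧ (d = Direction.south → i < k) ∧ (d = Direction.east → k < j) := by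
  induction h with
  | south_exit i j h => exact ⟨hij.le, le_rfl, fun _ => hij, nofun⟩
  | south_turn i i' j k hi h1 h0 _ ih =>
    obtain ⟨ha, hb, -, -⟩ := ih (lt_of_one h1)
    exact ⟨hi.le.trans ha, hb, fun _ => hi.trans_le ha, nofun⟩
  | east_exit i j h => exact ⟨le_rfl, hij.le, nofun, fun _ => hij⟩
  | east_turn i j j' k hj h1 h0 _ ih =>
    obtain ⟨ha, hb, -, -⟩ := ih (lt_of_one h1)
    exact ⟨ha, hb.trans hj.le, nofun, fun _ => hb.trans_lt hj⟩

theorem ZigzagEnd.le_of_isRow {T : PermutationTableau n} {x k : Fin n}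
    (h : T.ZigzagEnd x k) (hx : T.IsRow x) : x ≤ k := by
  cases h with
  | zero_row => exact le_rfl
  | row _ j _ hi h1 h0 h => exact (h.bounds (lt_of_one h1)).1
  | col _ _ _ hj => exact absurd hj hx.not_isCol

theorem ZigzagEnd.lt_of_isCol {T : PermutationTableau n} {x k : Fin n}
    (h : T.ZigzagEnd x k) (hx : T.IsCol x) : k < x := by
  cases h with
  | zero_row _ hi => exact absurd hx hi.not_isCol
  | row _ _ _ hi => exact absurd hx hi.not_isCol
  | col i _ _ hj h1 h0 h => exact (h.bounds (lt_of_one h1)).2.2.2 rfl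

/-- A row that has a `1` starts its path to the south and hence ends strictly beyond its own label.
-/
theorem ZigzagEnd.zero_of_isRow {T : PermutationTableau n} {x : Fin n}
    (h : T.ZigzagEnd x x) (hx : T.IsRow x) (j : Fin n) : T.one x j = false := by
  cases h with
  | zero_row _ _ h => exact h j
  | row _ j _ hi h1 h0 h => exact absurd ((h.bounds (lt_of_one h1)).2.2.1 rfl) (lt_irrefl _)
  | col _ _ _ hj => exact absurd hj hx.not_isCol

/-! ### Deleting a line, and adding a corner -/

/-- `D` is the filled diagram `T` without the line labelled `r`. -/
def IsDeletion (T : PermutationTableau (N + 1)) (r : Fin (N + 1)) (D : PermutationTableau N) :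
    Prop :=
  (∀ k, T.south (r.succAbove k) = D.south k) ∧
    ∀ k l, T.one (r.succAbove k) (r.succAbove l) = D.one k l

/-! ### Inserting an all-zero row -/

section zeroRow

variable {T : PermutationTableau (N + 1)} {r : Fin (N + 1)} {D : PermutationTableau N}

theorem one_col_eq_false {T : PermutationTableau n} {r : Fin n} (hr : T.IsRow r) (k : Fin n) :
    T.one k r = false := by
  by_contra h
  exact hr.not_isCol (isCol_of_one (by simpa using h))

theorem one_row_eq_false {T : PermutationTableau n} {r : Fin n} (hr : T.IsCol r) (k : Fin n) :
    T.one r k = false := by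
  by_contra h
  exact (isRow_of_one (by simpa using h)).not_isCol hr

/-- The label `r` contributes no vertex, neither as a row (it is zero) nor as a column (it is none),
so the paths of `D` survive with their labels shifted. -/
theorem IsDeletion.zigzagFrom_zeroRow (h : T.IsDeletion r D) (hz : ∀ j, T.one r j = false)
    (hr : T.IsRow r) {d : Direction} {i j k : Fin N} (hk : D.ZigzagFrom d i j k) :
    T.ZigzagFrom d (r.succAbove i) (r.succAbove j) (r.succAbove k) := by
  have hz' := one_col_eq_false hr
  induction hk with
  | south_exit i j h' =>
    refine .south_exit _ _ fun x hx => ?_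
    rcases Fin.eq_self_or_eq_succAbove r x with rfl | ⟨y, rfl⟩
    · exact hz _
    · rw [h.2]; exact h' _ (Fin.succAbove_lt_succAbove_iff.1 hx)
  | south_turn i i' j k hi h1 h0 _ ih =>
    refine .south_turn _ _ _ _ (Fin.succAbove_lt_succAbove_iff.2 hi) (by rwa [h.2])
      (fun x hx hx' => ?_) ih
    rcases Fin.eq_self_or_eq_succAbove r x with rfl | ⟨y, rfl⟩
    · exact hz _
    · rw [h.2]
      exact h0 _ (Fin.succAbove_lt_succAbove_iff.1 hx) (Fin.succAbove_lt_succAbove_iff.1 hx')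
  | east_exit i j h' =>
    refine .east_exit _ _ fun x hx => ?_
    rcases Fin.eq_self_or_eq_succAbove r x with rfl | ⟨y, rfl⟩
    · exact hz' _
    · rw [h.2]; exact h' _ (Fin.succAbove_lt_succAbove_iff.1 hx)
  | east_turn i j j' k hj h1 h0 _ ih =>
    refine .east_turn _ _ _ _ (Fin.succAbove_lt_succAbove_iff.2 hj) (by rwa [h.2])
      (fun x hx hx' => ?_) ih
    rcases Fin.eq_self_or_eq_succAbove r x with rfl | ⟨y, rfl⟩
    · exact hz' _
    · rw [h.2]
      exact h0 _ (Fin.succAbove_lt_succAbove_iff.1 hx) (Fin.succAbove_lt_succAbove_iff.1 hx')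

theorem IsDeletion.zigzagEnd_zeroRow (h : T.IsDeletion r D) (hz : ∀ j, T.one r j = false)
    (hr : T.IsRow r) {x k : Fin N} (hk : D.ZigzagEnd x k) :
    T.ZigzagEnd (r.succAbove x) (r.succAbove k) := by
  have hz' := one_col_eq_false hr
  cases hk with
  | zero_row _ hi h' =>
    refine .zero_row _ ((h.1 _).trans hi) fun x => ?_
    rcases Fin.eq_self_or_eq_succAbove r x with rfl | ⟨y, rfl⟩
    · exact hz' _
    · rw [h.2]; exact h' _
  | row _ j _ hi h1 h0 h' =>
    refine .row _ (r.succAbove j) _ ((h.1 _).trans hi) (by rwa [h.2]) (fun x hx => ?_)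
      (h.zigzagFrom_zeroRow hz hr h')
    rcases Fin.eq_self_or_eq_succAbove r x with rfl | ⟨y, rfl⟩
    · exact hz' _
    · rw [h.2]; exact h0 _ (Fin.succAbove_lt_succAbove_iff.1 hx)
  | col i _ _ hj h1 h0 h' =>
    refine .col (r.succAbove i) _ _ ((h.1 _).trans hj) (by rwa [h.2]) (fun x hx => ?_)
      (h.zigzagFrom_zeroRow hz hr h')
    rcases Fin.eq_self_or_eq_succAbove r x with rfl | ⟨y, rfl⟩
    · exact hz _
    · rw [h.2]; exact h0 _ (Fin.succAbove_lt_succAbove_iff.1 hx)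

end zeroRow

/-- Column `r` immediately follows row `i` on the border, and its only `1` is in that row. -/
def IsNecessaryCorner (T : PermutationTableau n) (i r : Fin n) : Prop :=
  r.val = i.val + 1 ∧ T.IsRow i ∧ T.IsCol r ∧ ∀ k, T.one k r = true ↔ k = i

/-! ### Inserting a column with a single `1` at a corner -/

section necessaryCorner

variable {T : PermutationTableau (N + 1)} {i r : Fin (N + 1)} {D : PermutationTableau N}

theorem IsNecessaryCorner.one_eq_false {T : PermutationTableau n} {i r : Fin n}
    (hc : T.IsNecessaryCorner i r) {k : Fin n} (hk : k ≠ i) : T.one k r = false := by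
  by_contra h
  exact hk ((hc.2.2.2 k).1 (by simpa using h))

/-- The labels `i` and `r` are consecutive, so every other `1` of row `i` stands to the left of the
corner: the corner is the last vertex before the border of row `i`. -/
theorem IsNecessaryCorner.lt {T : PermutationTableau n} {i r : Fin n}
    (hc : T.IsNecessaryCorner i r) {j : Fin n} (hij : T.one i j = true) (hj : j ≠ r) : r < j := by
  have := lt_of_one hij
  have := hc.1
  rw [Fin.lt_def] at *
  have : j.val ≠ r.val := fun h => hj (Fin.ext h)
  omega

theorem IsNecessaryCorner.zigzagEnd {T : PermutationTableau n} {i r : Fin n}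
    (hc : T.IsNecessaryCorner i r) : T.ZigzagEnd r i := by
  refine .col i _ _ hc.2.2.1 ((hc.2.2.2 i).2 rfl) (fun x hx => hc.one_eq_false hx.ne) ?_
  refine .east_exit _ _ fun x hx => ?_
  by_contra h
  have := hc.lt (by simpa using h) hx.ne
  exact lt_asymm this hx

theorem IsNecessaryCorner.swap_of_isCol {T : PermutationTableau n} {i r : Fin n}
    (hc : T.IsNecessaryCorner i r) {j : Fin n} (hj : T.IsCol j) (hr : j ≠ r) :
    swap i r j = j :=
  swap_apply_of_ne_of_ne (fun h => hc.2.1.not_isCol (h ▸ hj)) hr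

/-- A path that left the diagram eastwards through row `i` now meets the corner, turns south and
leaves through column `r`. All other paths miss the corner. The end `r.succAbove k` is never `r`, so
the swap expresses just this replacement of `i` by `r`. -/
theorem IsDeletion.zigzagFrom_necessaryCorner (h : T.IsDeletion r D) (hc : T.IsNecessaryCorner i r)
    {d : Direction} {a b k : Fin N} (hk : D.ZigzagFrom d a b k) (hab : D.one a b = true) :
    T.ZigzagFrom d (r.succAbove a) (r.succAbove b) (swap i r (r.succAbove k)) := by
  have hz := one_row_eq_false hc.2.2.1
  induction hk with
  | south_exit a b h' =>
    rw [hc.swap_of_isCol (isCol_of_one ((h.2 _ _).trans hab)) (Fin.succAbove_ne _ _)]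
    refine .south_exit _ _ fun x hx => ?_
    rcases Fin.eq_self_or_eq_succAbove r x with rfl | ⟨y, rfl⟩
    · exact hz _
    · rw [h.2]; exact h' _ (Fin.succAbove_lt_succAbove_iff.1 hx)
  | south_turn i i' j k hi h1 h0 _ ih =>
    refine .south_turn _ _ _ _ (Fin.succAbove_lt_succAbove_iff.2 hi) (by rwa [h.2])
      (fun x hx hx' => ?_) (ih h1)
    rcases Fin.eq_self_or_eq_succAbove r x with rfl | ⟨y, rfl⟩
    · exact hz _
    · rw [h.2]
      exact h0 _ (Fin.succAbove_lt_succAbove_iff.1 hx) (Fin.succAbove_lt_succAbove_iff.1 hx')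
  | east_exit a b h' =>
    have key : ∀ y, y < r.succAbove b → y ≠ r → T.one (r.succAbove a) y = false := by
      intro x hx hxr
      rcases Fin.eq_self_or_eq_succAbove r x with rfl | ⟨y, rfl⟩
      · exact absurd rfl hxr
      · rw [h.2]; exact h' _ (Fin.succAbove_lt_succAbove_iff.1 hx)
    by_cases ha : r.succAbove a = i
    · rw [ha, swap_apply_left]
      have hlt := hc.lt (ha ▸ (h.2 _ _).trans hab) (Fin.succAbove_ne _ _)
      refine .east_turn _ _ r _ hlt ((hc.2.2.2 i).2 rfl) (fun x hx hx' => ?_) ?_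
      · rw [← ha]; exact key _ hx' hx.ne'
      · exact .south_exit _ _ fun x hx => hc.one_eq_false hx.ne'
    · rw [swap_apply_of_ne_of_ne ha (Fin.succAbove_ne _ _)]
      refine .east_exit _ _ fun x hx => ?_
      by_cases hxr : x = r
      · rw [hxr]; exact hc.one_eq_false ha
      · exact key _ hx hxr
  | east_turn a j j' k hj h1 h0 _ ih =>
    refine .east_turn _ _ _ _ (Fin.succAbove_lt_succAbove_iff.2 hj) (by rwa [h.2])
      (fun x hx hx' => ?_) (ih h1)
    rcases Fin.eq_self_or_eq_succAbove r x with rfl | ⟨y, rfl⟩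
    · refine hc.one_eq_false fun ha => ?_
      exact lt_asymm hx (hc.lt (ha ▸ (h.2 _ _).trans h1) (Fin.succAbove_ne _ _))
    · rw [h.2]
      exact h0 _ (Fin.succAbove_lt_succAbove_iff.1 hx) (Fin.succAbove_lt_succAbove_iff.1 hx')

theorem IsDeletion.zigzagEnd_necessaryCorner (h : T.IsDeletion r D) (hc : T.IsNecessaryCorner i r)
    {x k : Fin N} (hk : D.ZigzagEnd x k) :
    T.ZigzagEnd (r.succAbove x) (swap i r (r.succAbove k)) := by
  have hz := one_row_eq_false hc.2.2.1
  cases hk with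
  | zero_row _ hi h' =>
    have key : ∀ y, y ≠ r → T.one (r.succAbove x) y = false := by
      intro z hxr
      rcases Fin.eq_self_or_eq_succAbove r z with rfl | ⟨y, rfl⟩
      · exact absurd rfl hxr
      · rw [h.2]; exact h' _
    -- If row `i` had no `1`, the corner is now its only one, and the formerly trivial path goes
    -- south from it to `r`.
    by_cases ha : r.succAbove x = i
    · rw [ha, swap_apply_left]
      refine .row _ r _ hc.2.1 ((hc.2.2.2 i).2 rfl) (fun z hz => ?_) ?_
      · rw [← ha]; exact key _ hz.ne'
      · exact .south_exit _ _ fun x hx => hc.one_eq_false hx.ne'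
    · rw [swap_apply_of_ne_of_ne ha (Fin.succAbove_ne _ _)]
      refine .zero_row _ ((h.1 _).trans hi) fun z => ?_
      by_cases hxr : z = r
      · rw [hxr]; exact hc.one_eq_false ha
      · exact key _ hxr
  | row _ j _ hi h1 h0 h' =>
    refine .row _ (r.succAbove j) _ ((h.1 _).trans hi) (by rwa [h.2]) (fun x hx => ?_)
      (h.zigzagFrom_necessaryCorner hc h' h1)
    rcases Fin.eq_self_or_eq_succAbove r x with rfl | ⟨y, rfl⟩
    · refine hc.one_eq_false fun ha => ?_
      exact lt_asymm hx (hc.lt (ha ▸ (h.2 _ _).trans h1) (Fin.succAbove_ne _ _))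
    · rw [h.2]; exact h0 _ (Fin.succAbove_lt_succAbove_iff.1 hx)
  | col i _ _ hj h1 h0 h' =>
    refine .col (r.succAbove i) _ _ ((h.1 _).trans hj) (by rwa [h.2]) (fun x hx => ?_)
      (h.zigzagFrom_necessaryCorner hc h' h1)
    rcases Fin.eq_self_or_eq_succAbove r x with rfl | ⟨y, rfl⟩
    · exact hz _
    · rw [h.2]; exact h0 _ (Fin.succAbove_lt_succAbove_iff.1 hx)

end necessaryCorner

/-! ### Adding a box with a `1` at an inner corner -/

section addCorner

variable {S T : PermutationTableau n} {i i' : Fin n}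

theorem AddCorner.one_swap (h : S.AddCorner T i i') (a b : Fin n) :
    T.one (swap i i' a) (swap i i' b) = true ↔ (a = i' ∧ b = i) ∨ S.one a b = true := by
  rw [h.2.2.2.2, swap_apply_self, swap_apply_self, swap_apply_eq_iff, swap_apply_eq_iff,
    swap_apply_left, swap_apply_right]

/-- An adjacent transposition reverses the order of that one pair only. In `S` the pair consists of
a column and a row, so the order among the rows and among the columns is never affected. -/
theorem swap_lt_swap_of_lt {i i' a b : Fin n} (hi : i'.val = i.val + 1) (hab : a < b)
    (h : ¬ (a = i ∧ b = i')) : swap i i' a < swap i i' b := by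
  rw [swap_apply_def, swap_apply_def]
  simp only [Fin.ext_iff, Fin.lt_def] at *
  split_ifs <;> omega

theorem AddCorner.swap_lt_swap_row (h : S.AddCorner T i i') {a b : Fin n} (ha : S.IsRow a)
    (hb : S.IsRow b) : swap i i' a < swap i i' b ↔ a < b := by
  refine ⟨fun hlt => ?_, fun hlt => swap_lt_swap_of_lt h.1 hlt ?_⟩
  · have := swap_lt_swap_of_lt h.1 hlt ?_
    · simpa using this
    · rintro ⟨-, hb'⟩
      rw [swap_apply_eq_iff, swap_apply_right] at hb'
      exact hb.not_isCol (hb' ▸ h.2.1)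
  · rintro ⟨rfl, -⟩
    exact ha.not_isCol h.2.1

theorem AddCorner.swap_lt_swap_col (h : S.AddCorner T i i') {a b : Fin n} (ha : S.IsCol a)
    (hb : S.IsCol b) : swap i i' a < swap i i' b ↔ a < b := by
  refine ⟨fun hlt => ?_, fun hlt => swap_lt_swap_of_lt h.1 hlt ?_⟩
  · have := swap_lt_swap_of_lt h.1 hlt ?_
    · simpa using this
    · rintro ⟨ha', -⟩
      rw [swap_apply_eq_iff, swap_apply_left] at ha'
      exact h.2.2.1.not_isCol (ha' ▸ ha)
  · rintro ⟨-, rfl⟩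
    exact h.2.2.1.not_isCol hb

theorem AddCorner.isRow_swap (h : S.AddCorner T i i') {a : Fin n} :
    T.IsRow (swap i i' a) ↔ S.IsRow a := by
  rw [IsRow, h.2.2.2.1, swap_apply_self, IsRow]

theorem AddCorner.isCol_swap (h : S.AddCorner T i i') {a : Fin n} :
    T.IsCol (swap i i' a) ↔ S.IsCol a := by
  rw [IsCol, h.2.2.2.1, swap_apply_self, IsCol]

theorem AddCorner.one_corner (h : S.AddCorner T i i') : T.one i i' = true :=
  (h.2.2.2.2 _ _).2 (Or.inl ⟨rfl, rfl⟩)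

theorem AddCorner.one_left_eq_false (h : S.AddCorner T i i') {x : Fin n} (hx : x < i') :
    T.one i x = false := by
  by_contra hc
  have := lt_of_one (by simpa using hc)
  have := h.1
  simp only [Fin.lt_def] at *
  omega

theorem AddCorner.one_right_eq_false (h : S.AddCorner T i i') {x : Fin n} (hx : i < x) :
    T.one x i' = false := by
  by_contra hc
  have := lt_of_one (by simpa using hc)
  have := h.1
  simp only [Fin.lt_def] at *
  omega

/-- The end `k` is not swapped because two effects cancel. A path leaving `S` through column `i`
meets the new `1`, turns east and leaves through the enlarged row, whose label in `T` is again `i`;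
likewise a path leaving through row `i'` is turned into the column that `T` labels `i'`. -/
theorem AddCorner.zigzagFrom (h : S.AddCorner T i i') {d : Direction} {a b k : Fin n}
    (hk : S.ZigzagFrom d a b k) (hab : S.one a b = true) :
    T.ZigzagFrom d (swap i i' a) (swap i i' b) k := by
  induction hk with
  | south_exit a b h' =>
    have key : ∀ y, swap i i' a < swap i i' y → ¬ (y = i' ∧ b = i) →
        T.one (swap i i' y) (swap i i' b) = false := by
      intro y hy hne
      by_contra hc
      rcases (h.one_swap _ _).1 (by simpa using hc) with hc | hc
      · exact hne hc
      · rw [h' y ((h.swap_lt_swap_row (isRow_of_one hab) (isRow_of_one hc)).1 hy)] at hc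
        exact absurd hc (by simp)
    by_cases hb : b = i
    · subst hb
      have hlt : swap b i' a < b := by
        have := (h.swap_lt_swap_row (isRow_of_one hab) h.2.2.1).2
          ((lt_of_one hab).trans (by simp [Fin.lt_def, h.1]))
        rwa [swap_apply_right] at this
      rw [swap_apply_left] at key ⊢
      refine .south_turn _ b _ _ hlt h.one_corner (fun x hx hx' => ?_)
        (.east_exit _ _ fun x hx => h.one_left_eq_false hx)
      obtain ⟨y, rfl⟩ := (swap b i').surjective x
      refine key y hx ?_
      rintro ⟨rfl, -⟩
      rw [swap_apply_right] at hx'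
      exact lt_irrefl _ hx'
    · have hb' : b ≠ i' := fun e => h.2.2.1.not_isCol (e ▸ isCol_of_one hab)
      have := ZigzagFrom.south_exit (T := T) (swap i i' a) (swap i i' b) fun x hx => by
        obtain ⟨y, rfl⟩ := (swap i i').surjective x
        exact key y hx fun e => hb e.2
      rwa [swap_apply_of_ne_of_ne hb hb'] at this ⊢
  | south_turn a a' b k ha h1 h0 _ ih =>
    refine .south_turn _ _ _ _ ((h.swap_lt_swap_row (isRow_of_one hab) (isRow_of_one h1)).2 ha)
      ((h.one_swap _ _).2 (Or.inr h1)) (fun x hx hx' => ?_) (ih h1)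
    obtain ⟨y, rfl⟩ := (swap i i').surjective x
    by_contra hc
    -- The new `1` is the lowest box of its column, so it cannot lie strictly between two old
    -- vertices of that column.
    rcases (h.one_swap _ _).1 (by simpa using hc) with ⟨rfl, rfl⟩ | hc
    · have h2 := (h.swap_lt_swap_row h.2.2.1 (isRow_of_one h1)).1 hx'
      have h3 := lt_of_one h1
      have := h.1
      simp only [Fin.lt_def] at *
      omega
    · have hy := isRow_of_one hc
      rw [h0 y ((h.swap_lt_swap_row (isRow_of_one hab) hy).1 hx)
        ((h.swap_lt_swap_row hy (isRow_of_one h1)).1 hx')] at hc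
      exact absurd hc (by simp)
  | east_exit a b h' =>
    have key : ∀ y, swap i i' y < swap i i' b → ¬ (a = i' ∧ y = i) →
        T.one (swap i i' a) (swap i i' y) = false := by
      intro y hy hne
      by_contra hc
      rcases (h.one_swap _ _).1 (by simpa using hc) with hc | hc
      · exact hne hc
      · rw [h' y ((h.swap_lt_swap_col (isCol_of_one hc) (isCol_of_one hab)).1 hy)] at hc
        exact absurd hc (by simp)
    by_cases ha : a = i'
    · subst ha
      have hlt : a < swap i a b := by
        have := (h.swap_lt_swap_col h.2.1 (isCol_of_one hab)).2
          (lt_trans (by simp [Fin.lt_def, h.1]) (lt_of_one hab))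
        rwa [swap_apply_left] at this
      rw [swap_apply_right] at key ⊢
      refine .east_turn _ _ a _ hlt h.one_corner (fun x hx hx' => ?_)
        (.south_exit _ _ fun x hx => h.one_right_eq_false hx)
      obtain ⟨y, rfl⟩ := (swap i a).surjective x
      refine key y hx' ?_
      rintro ⟨-, rfl⟩
      rw [swap_apply_left] at hx
      exact lt_irrefl _ hx
    · have ha' : a ≠ i := fun e => (isRow_of_one hab).not_isCol (e ▸ h.2.1)
      have := ZigzagFrom.east_exit (T := T) (swap i i' a) (swap i i' b) fun x hx => by
        obtain ⟨y, rfl⟩ := (swap i i').surjective x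
        exact key y hx fun e => ha e.1
      rwa [swap_apply_of_ne_of_ne ha' ha] at this ⊢
  | east_turn a b b' k hb h1 h0 _ ih =>
    refine .east_turn _ _ _ _ ((h.swap_lt_swap_col (isCol_of_one h1) (isCol_of_one hab)).2 hb)
      ((h.one_swap _ _).2 (Or.inr h1)) (fun x hx hx' => ?_) (ih h1)
    obtain ⟨y, rfl⟩ := (swap i i').surjective x
    by_contra hc
    rcases (h.one_swap _ _).1 (by simpa using hc) with ⟨rfl, rfl⟩ | hc
    · have h2 := (h.swap_lt_swap_col (isCol_of_one h1) h.2.1).1 hx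
      have h3 := lt_of_one h1
      have := h.1
      simp only [Fin.lt_def] at *
      omega
    · have hy := isCol_of_one hc
      rw [h0 y ((h.swap_lt_swap_col (isCol_of_one h1) hy).1 hx)
        ((h.swap_lt_swap_col hy (isCol_of_one hab)).1 hx')] at hc
      exact absurd hc (by simp)

theorem AddCorner.zigzagEnd (h : S.AddCorner T i i') {x k : Fin n} (hk : S.ZigzagEnd x k) :
    T.ZigzagEnd (swap i i' x) k := by
  cases hk with
  | zero_row _ hx h' =>
    have key : ∀ y, ¬ (x = i' ∧ y = i) → T.one (swap i i' x) (swap i i' y) = false := by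
      intro y hne
      by_contra hc
      rcases (h.one_swap _ _).1 (by simpa using hc) with hc | hc
      · exact hne hc
      · rw [h' y] at hc
        exact absurd hc (by simp)
    by_cases ha : x = i'
    · subst ha
      rw [swap_apply_right] at key ⊢
      refine .row _ x _ (by simpa using h.isRow_swap.2 hx) h.one_corner (fun z hz => ?_)
        (.south_exit _ _ fun x hx => h.one_right_eq_false hx)
      obtain ⟨y, rfl⟩ := (swap i x).surjective z
      refine key y ?_
      rintro ⟨-, rfl⟩
      rw [swap_apply_left] at hz
      exact lt_irrefl _ hz
    · have ha' : x ≠ i := fun e => hx.not_isCol (e ▸ h.2.1)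
      have := ZigzagEnd.zero_row (T := T) (swap i i' x) (h.isRow_swap.2 hx) fun z => by
        obtain ⟨y, rfl⟩ := (swap i i').surjective z
        exact key y fun e => ha e.1
      rwa [swap_apply_of_ne_of_ne ha' ha] at this ⊢
  | row _ j _ hi h1 h0 h' =>
    refine .row _ (swap i i' j) _ (h.isRow_swap.2 hi) ((h.one_swap _ _).2 (Or.inr h1))
      (fun z hz => ?_) (h.zigzagFrom h' h1)
    obtain ⟨y, rfl⟩ := (swap i i').surjective z
    by_contra hc
    rcases (h.one_swap _ _).1 (by simpa using hc) with ⟨rfl, rfl⟩ | hc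
    · have h2 := (h.swap_lt_swap_col (isCol_of_one h1) h.2.1).1 hz
      have h3 := lt_of_one h1
      have := h.1
      simp only [Fin.lt_def] at *
      omega
    · rw [h0 y ((h.swap_lt_swap_col (isCol_of_one h1) (isCol_of_one hc)).1 hz)] at hc
      exact absurd hc (by simp)
  | col a _ _ hj h1 h0 h' =>
    refine .col (swap i i' a) _ _ (h.isCol_swap.2 hj) ((h.one_swap _ _).2 (Or.inr h1))
      (fun z hz => ?_) (h.zigzagFrom h' h1)
    obtain ⟨y, rfl⟩ := (swap i i').surjective z
    by_contra hc
    rcases (h.one_swap _ _).1 (by simpa using hc) with ⟨rfl, rfl⟩ | hc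
    · have h2 := (h.swap_lt_swap_row h.2.2.1 (isRow_of_one h1)).1 hz
      have h3 := lt_of_one h1
      have := h.1
      simp only [Fin.lt_def] at *
      omega
    · rw [h0 y ((h.swap_lt_swap_row (isRow_of_one hc) (isRow_of_one h1)).1 hz)] at hc
      exact absurd hc (by simp)

end addCorner

/-! ### Constructions of tableaux -/

/-- The tableau `S` without the line `p`, which is not the top row and has no `1`s if it is a row. -/
def deleteLine (S : PermutationTableau (N + 1)) (p : Fin (N + 1)) (hp : 1 ≤ p.val)
    (hz : S.IsRow p → ∀ j, S.one p j = false) : PermutationTableau N where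
  south k := S.south (p.succAbove k)
  one k l := S.one (p.succAbove k) (p.succAbove l)
  south_first k hk := by
    apply S.south_first
    rw [Fin.succAbove_of_castSucc_lt _ _ (by rw [Fin.lt_def]; simp; omega)]
    simpa using hk
  box_of_one i j h := by
    obtain ⟨h1, h2, h3⟩ := S.box_of_one _ _ h
    exact ⟨h1, h2, Fin.succAbove_lt_succAbove_iff.1 h3⟩
  exists_one j hj := by
    obtain ⟨i, hi⟩ := S.exists_one _ hj
    rcases Fin.eq_self_or_eq_succAbove p i with rfl | ⟨y, rfl⟩
    · rw [hz (isRow_of_one hi)] at hi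
      exact absurd hi (by simp)
    · exact ⟨y, hi⟩
  no_bad_zero i j hi hj hij h0 := by
    rintro ⟨⟨i', hi', h1⟩, j', hj', h2⟩
    exact S.no_bad_zero _ _ hi hj (Fin.succAbove_lt_succAbove_iff.2 hij) h0
      ⟨⟨_, Fin.succAbove_lt_succAbove_iff.2 hi', h1⟩, _, Fin.succAbove_lt_succAbove_iff.2 hj', h2⟩

theorem isDeletion_deleteLine (S : PermutationTableau (N + 1)) (p : Fin (N + 1)) (hp : 1 ≤ p.val)
    (hz : S.IsRow p → ∀ j, S.one p j = false) : S.IsDeletion p (S.deleteLine p hp hz) :=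
  ⟨fun _ => rfl, fun _ _ => rfl⟩

/-- The tableau `D` with a new all-zero row, which gets the label `r`. -/
def insertRow (D : PermutationTableau N) (r : Fin (N + 1)) : PermutationTableau (N + 1) where
  south := Fin.insertNth (α := fun _ => Bool) r true D.south
  one := Fin.insertNth (α := fun _ => Fin (N + 1) → Bool) r (fun _ => false)
    fun k => Fin.insertNth (α := fun _ => Bool) r false (D.one k)
  south_first k hk := by
    rcases Fin.eq_self_or_eq_succAbove r k with rfl | ⟨y, rfl⟩
    · simp
    · simp only [Fin.insertNth_apply_succAbove]
      apply D.south_first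
      by_contra hy
      have : (⟨0, by omega⟩ : Fin N) < y := by rw [Fin.lt_def]; simp; omega
      have := (Fin.succAbove_lt_succAbove_iff (p := r)).2 this
      rw [Fin.lt_def] at this
      omega
  box_of_one i j h := by
    rcases Fin.eq_self_or_eq_succAbove r i with rfl | ⟨x, rfl⟩
    · simp at h
    rcases Fin.eq_self_or_eq_succAbove r j with rfl | ⟨y, rfl⟩
    · simp at h
    simp only [Fin.insertNth_apply_succAbove, Fin.succAbove_lt_succAbove_iff] at h ⊢
    exact D.box_of_one _ _ h
  exists_one j hj := by
    rcases Fin.eq_self_or_eq_succAbove r j with rfl | ⟨y, rfl⟩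
    · simp at hj
    simp only [Fin.insertNth_apply_succAbove] at hj
    obtain ⟨i, hi⟩ := D.exists_one _ hj
    exact ⟨r.succAbove i, by simpa using hi⟩
  no_bad_zero i j hi hj hij h0 := by
    rintro ⟨⟨i', hi', h1⟩, j', hj', h2⟩
    rcases Fin.eq_self_or_eq_succAbove r i with rfl | ⟨x, rfl⟩
    · simp at h2
    rcases Fin.eq_self_or_eq_succAbove r j with rfl | ⟨y, rfl⟩
    · simp at hj
    rcases Fin.eq_self_or_eq_succAbove r i' with rfl | ⟨x', rfl⟩
    · simp at h1
    rcases Fin.eq_self_or_eq_succAbove r j' with rfl | ⟨y', rfl⟩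
    · simp at h2
    simp only [Fin.insertNth_apply_succAbove, Fin.succAbove_lt_succAbove_iff] at *
    exact D.no_bad_zero _ _ hi hj hij h0 ⟨⟨_, hi', h1⟩, _, hj', h2⟩

theorem isRow_insertRow (D : PermutationTableau N) (r : Fin (N + 1)) : (D.insertRow r).IsRow r := by
  simp [IsRow, insertRow]

theorem insertRow_zero (D : PermutationTableau N) (r j : Fin (N + 1)) :
    (D.insertRow r).one r j = false := by
  simp [insertRow]

theorem isDeletion_insertRow (D : PermutationTableau N) (r : Fin (N + 1)) :
    (D.insertRow r).IsDeletion r D := by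
  simp [IsDeletion, insertRow]

/-- The tableau `D` with a new column just after the row `i` on the border, whose only `1` is in
row `i`. -/
def insertCol (D : PermutationTableau N) (i : Fin N) (hi : D.IsRow i) :
    PermutationTableau (N + 1) where
  south := Fin.insertNth (α := fun _ => Bool) i.succ false D.south
  one := Fin.insertNth (α := fun _ => Fin (N + 1) → Bool) i.succ (fun _ => false)
    fun k => Fin.insertNth (α := fun _ => Bool) i.succ (decide (k = i)) (D.one k)
  south_first k hk := by
    rcases Fin.eq_self_or_eq_succAbove i.succ k with rfl | ⟨y, rfl⟩
    · simp at hk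
    · simp only [Fin.insertNth_apply_succAbove]
      apply D.south_first
      by_contra hy
      have : (⟨0, by omega⟩ : Fin N) < y := by rw [Fin.lt_def]; simp; omega
      have := (Fin.succAbove_lt_succAbove_iff (p := i.succ)).2 this
      rw [Fin.lt_def] at this
      omega
  box_of_one k l h := by
    rcases Fin.eq_self_or_eq_succAbove i.succ k with rfl | ⟨x, rfl⟩
    · simp at h
    rcases Fin.eq_self_or_eq_succAbove i.succ l with rfl | ⟨y, rfl⟩
    · simp only [Fin.insertNth_apply_succAbove, Fin.insertNth_apply_same, decide_eq_true_eq] at h ⊢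
      subst h
      refine ⟨hi, trivial, ?_⟩
      rw [Fin.succAbove_succ_self, Fin.lt_def]
      simp
    simp only [Fin.insertNth_apply_succAbove, Fin.succAbove_lt_succAbove_iff] at h ⊢
    exact D.box_of_one _ _ h
  exists_one j hj := by
    rcases Fin.eq_self_or_eq_succAbove i.succ j with rfl | ⟨y, rfl⟩
    · exact ⟨i.succ.succAbove i, by rw [Fin.insertNth_apply_succAbove]; simp⟩
    simp only [Fin.insertNth_apply_succAbove] at hj
    obtain ⟨i', hi'⟩ := D.exists_one _ hj
    exact ⟨i.succ.succAbove i', by simpa using hi'⟩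
  no_bad_zero k l hk hl hkl h0 := by
    rintro ⟨⟨k', hk', h1⟩, l', hl', h2⟩
    rcases Fin.eq_self_or_eq_succAbove i.succ k with rfl | ⟨x, rfl⟩
    · simp at hk
    rcases Fin.eq_self_or_eq_succAbove i.succ k' with rfl | ⟨x', rfl⟩
    · simp at h1
    -- The new `1` creates no bad `0`: the new column has no box below row `i`, and row `i` has no
    -- box to the right of the new column.
    rcases Fin.eq_self_or_eq_succAbove i.succ l with rfl | ⟨y, rfl⟩
    · simp only [Fin.insertNth_apply_succAbove, Fin.insertNth_apply_same, decide_eq_true_eq] at h1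
      subst h1
      rw [Fin.succAbove_succ_self, Fin.lt_def] at hk'
      rw [Fin.lt_def] at hkl
      simp at hk' hkl
      omega
    rcases Fin.eq_self_or_eq_succAbove i.succ l' with rfl | ⟨y', rfl⟩
    · simp only [Fin.insertNth_apply_succAbove, Fin.insertNth_apply_same, decide_eq_true_eq] at h2
      subst h2
      rw [Fin.succAbove_succ_self, Fin.lt_def] at hkl
      rw [Fin.lt_def] at hl'
      simp at hl' hkl
      omega
    simp only [Fin.insertNth_apply_succAbove, Fin.succAbove_lt_succAbove_iff] at *
    exact D.no_bad_zero _ _ hk hl hkl h0 ⟨⟨_, hk', h1⟩, _, hl', h2⟩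

theorem isDeletion_insertCol (D : PermutationTableau N) (i : Fin N) (hi : D.IsRow i) :
    (D.insertCol i hi).IsDeletion i.succ D := by
  simp [IsDeletion, insertCol]

theorem isNecessaryCorner_insertCol (D : PermutationTableau N) (i : Fin N) (hi : D.IsRow i) :
    (D.insertCol i hi).IsNecessaryCorner i.castSucc i.succ := by
  refine ⟨by simp, ?_, by simp [IsCol, insertCol], fun k => ?_⟩
  · rw [← Fin.succAbove_succ_self]
    exact ((D.isDeletion_insertCol i hi).1 i).trans hi
  · rcases Fin.eq_self_or_eq_succAbove i.succ k with rfl | ⟨x, rfl⟩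
    · simp [insertCol, Fin.ext_iff]
    · rw [← Fin.succAbove_succ_self, Fin.succAbove_right_inj]
      simp [insertCol]

theorem isCol_iff_not_isRow {T : PermutationTableau n} {k : Fin n} : T.IsCol k ↔ ¬ T.IsRow k :=
  not_isRow.symm

theorem isRow_or_isCol (T : PermutationTableau n) (k : Fin n) : T.IsRow k ∨ T.IsCol k := by
  simp [IsRow, IsCol]

/-- The tableau `S` with one more box, containing a `1`, at the end of the row `i'`, where `i`, `i'`
are a column and a row that follow each other on the border. -/
def addCorner (S : PermutationTableau n) (i i' : Fin n) (h : i'.val = i.val + 1) (hi : S.IsCol i)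
    (hi' : S.IsRow i') : PermutationTableau n where
  south k := S.south (swap i i' k)
  one k l := decide (k = i ∧ l = i') || S.one (swap i i' k) (swap i i' l)
  south_first k hk := by
    by_cases h1 : k = i
    · rw [h1, swap_apply_left]; exact hi'
    · rw [swap_apply_of_ne_of_ne h1 (by rintro rfl; omega)]
      exact S.south_first k hk
  box_of_one k l hkl := by
    simp only [Bool.or_eq_true, decide_eq_true_eq] at hkl
    rcases hkl with ⟨rfl, rfl⟩ | hkl
    · rw [swap_apply_left, swap_apply_right]
      exact ⟨hi', hi, by rw [Fin.lt_def]; omega⟩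
    · obtain ⟨h1, h2, h3⟩ := S.box_of_one _ _ hkl
      refine ⟨h1, h2, ?_⟩
      have := swap_lt_swap_of_lt h h3 ?_
      · simpa using this
      · rintro ⟨e, -⟩
        rw [e] at h1
        exact IsRow.not_isCol h1 hi
  exists_one j hj := by
    obtain ⟨k, hk⟩ := S.exists_one _ hj
    exact ⟨swap i i' k, by simp [hk]⟩
  no_bad_zero k l hk hl hkl h0 := by
    simp only [Bool.or_eq_true, Bool.or_eq_false_iff, decide_eq_true_eq,
      decide_eq_false_iff_not] at *
    obtain ⟨hne, h0⟩ := h0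
    rintro ⟨⟨k', hk', h1⟩, l', hl', h2⟩
    have h1 : S.one (swap i i' k') (swap i i' l) = true := by
      refine h1.resolve_left ?_
      rintro ⟨rfl, rfl⟩
      simp only [Fin.lt_def] at *
      omega
    have h2 : S.one (swap i i' k) (swap i i' l') = true := by
      refine h2.resolve_left ?_
      rintro ⟨rfl, rfl⟩
      simp only [Fin.lt_def] at *
      omega
    refine S.no_bad_zero _ _ hk hl ?_ h0 ⟨⟨_, ?_, h1⟩, _, ?_, h2⟩
    · exact swap_lt_swap_of_lt h hkl hne
    · refine swap_lt_swap_of_lt h hk' ?_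
      rintro ⟨-, rfl⟩
      rw [swap_apply_right] at hk
      exact IsRow.not_isCol hk hi
    · refine swap_lt_swap_of_lt h hl' ?_
      rintro ⟨rfl, -⟩
      rw [swap_apply_left] at hl
      exact IsRow.not_isCol hi' hl

theorem addCorner_addCorner (S : PermutationTableau n) (i i' : Fin n) (h : i'.val = i.val + 1)
    (hi : S.IsCol i) (hi' : S.IsRow i') : S.AddCorner (S.addCorner i i' h hi hi') i i' :=
  ⟨h, hi, hi', fun _ => rfl, fun k l => by simp [addCorner]⟩

/-- The tableau `T` without the box in which row `i` and column `i'` meet, which contains a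
superfluous `1` and is the last one of its row and of its column. -/
def removeCorner (T : PermutationTableau n) (i i' : Fin n) (h : i'.val = i.val + 1)
    (hi : T.IsRow i) (hi' : T.IsCol i') (h1 : ∃ k, k < i ∧ T.one k i' = true) :
    PermutationTableau n where
  south k := T.south (swap i i' k)
  one k l := !decide (k = i' ∧ l = i) && T.one (swap i i' k) (swap i i' l)
  south_first k hk := by
    obtain ⟨m, hm, -⟩ := h1
    rw [Fin.lt_def] at hm
    rw [swap_apply_of_ne_of_ne (by rintro rfl; omega) (by rintro rfl; omega)]
    exact T.south_first k hk
  box_of_one k l hkl := by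
    simp only [Bool.and_eq_true, Bool.not_eq_true', decide_eq_false_iff_not] at hkl
    obtain ⟨hne, hkl⟩ := hkl
    obtain ⟨h1, h2, h3⟩ := T.box_of_one _ _ hkl
    refine ⟨h1, h2, ?_⟩
    have := swap_lt_swap_of_lt h h3 ?_
    · simpa using this
    · rwa [swap_apply_eq_iff, swap_apply_eq_iff, swap_apply_left, swap_apply_right]
  exists_one j hj := by
    -- The shortened column has the label `i` after the swap; the superfluity of the removed `1`
    -- leaves it another `1`.
    by_cases hji : j = i
    · obtain ⟨m, hm, hm'⟩ := h1
      have hm2 : m ≠ i' := by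
        rintro rfl
        rw [Fin.lt_def] at hm
        omega
      exact ⟨m, by simp [hji, hm', swap_apply_of_ne_of_ne hm.ne hm2, hm2]⟩
    · obtain ⟨k, hk⟩ := T.exists_one _ hj
      exact ⟨swap i i' k, by simp [hk, hji]⟩
  no_bad_zero k l hk hl hkl h0 := by
    have hne : ¬ (k = i' ∧ l = i) := by
      rintro ⟨rfl, rfl⟩
      rw [Fin.lt_def] at hkl
      omega
    rintro ⟨⟨k', hk', h1⟩, l', hl', h2⟩
    simp only [hne, Bool.and_eq_true, decide_false, Bool.not_false, Bool.true_and] at *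
    refine T.no_bad_zero _ _ hk hl ?_ h0 ⟨⟨_, ?_, h1.2⟩, _, ?_, h2.2⟩
    · refine swap_lt_swap_of_lt h hkl ?_
      rintro ⟨rfl, -⟩
      rw [swap_apply_left] at hk
      exact IsRow.not_isCol hk hi'
    · refine swap_lt_swap_of_lt h hk' ?_
      rintro ⟨rfl, -⟩
      have := isRow_of_one h1.2
      rw [swap_apply_left] at this
      exact IsRow.not_isCol this hi'
    · refine swap_lt_swap_of_lt h hl' ?_
      rintro ⟨-, rfl⟩
      have := isCol_of_one h2.2
      rw [swap_apply_right] at this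
      exact IsRow.not_isCol hi this

theorem addCorner_removeCorner (T : PermutationTableau n) (i i' : Fin n) (h : i'.val = i.val + 1)
    (hi : T.IsRow i) (hi' : T.IsCol i') (h1 : ∃ k, k < i ∧ T.one k i' = true)
    (hone : T.one i i' = true) : (T.removeCorner i i' h hi hi' h1).AddCorner T i i' := by
  refine ⟨h, by simpa [IsCol, removeCorner] using hi', by simpa [IsRow, removeCorner] using hi,
    fun k => by simp [removeCorner], fun k l => ?_⟩
  simp only [removeCorner, swap_apply_self, Bool.and_eq_true, Bool.not_eq_true',
    decide_eq_false_iff_not, swap_apply_eq_iff, swap_apply_left, swap_apply_right]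
  constructor
  · tauto
  · rintro (⟨rfl, rfl⟩ | h)
    · exact hone
    · exact h.2

/-! ### Induction on tableaux -/

/-- If the corner box is `0`, the `1` that column `i'` must contain lies above it, since row `i` is
the lowest row of the column. The tableau condition then forbids a `1` to the left of the box, and
the box is the last of its row, so the row is zero and is not the top one. -/
theorem corner_cases (T : PermutationTableau n) {i i' : Fin n} (h : i'.val = i.val + 1)
    (hi : T.IsRow i) (hi' : T.IsCol i') :
    (1 ≤ i.val ∧ T.one i i' = false ∧ ∀ j, T.one i j = false) ∨ T.IsNecessaryCorner i i' ∨
      (T.one i i' = true ∧ ∃ k, k < i ∧ T.one k i' = true) := by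
  cases hone : T.one i i' with
  | false =>
    left
    obtain ⟨k, hk⟩ := T.exists_one i' hi'
    have hki : k < i := by
      have := lt_of_one hk
      have : k.val ≠ i.val := fun e => by rw [Fin.ext e, hone] at hk; exact absurd hk (by simp)
      rw [Fin.lt_def] at *
      omega
    refine ⟨by rw [Fin.lt_def] at hki; omega, rfl, fun j => ?_⟩
    by_contra hj
    have hj : T.one i j = true := by simpa using hj
    have hlt := lt_of_one hj
    have hne : j.val ≠ i'.val := fun e => by rw [Fin.ext e, hone] at hj; exact absurd hj (by simp)
    refine T.no_bad_zero i i' hi hi' (by rw [Fin.lt_def]; omega) hone ⟨⟨k, hki, hk⟩, j, ?_, hj⟩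
    rw [Fin.lt_def] at *
    omega
  | true =>
    right
    by_cases hk : ∃ k, k < i ∧ T.one k i' = true
    · exact Or.inr ⟨rfl, hk⟩
    · refine Or.inl ⟨h, hi, hi', fun k => ⟨fun hk' => ?_, fun hk' => hk' ▸ hone⟩⟩
      have h1 := lt_of_one hk'
      have h2 : ¬ k < i := fun h2 => hk ⟨k, h2, hk'⟩
      rw [Fin.lt_def] at *
      exact Fin.ext (by omega)

/-- The rightmost column is preceded on the border by a row, because the first step goes south. -/
theorem exists_corner (T : PermutationTableau n) (h : ∃ k, T.IsCol k) :
    ∃ i i' : Fin n, i'.val = i.val + 1 ∧ T.IsRow i ∧ T.IsCol i' := by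
  obtain ⟨c, hc, hmin⟩ := WellFounded.has_min (wellFounded_lt (α := Fin n)) {k | T.IsCol k} h
  have hc0 : c.val ≠ 0 := fun h0 => IsRow.not_isCol (T.south_first c h0) hc
  refine ⟨⟨c.val - 1, by omega⟩, c, by simp; omega, ?_, hc⟩
  refine (T.isRow_or_isCol _).resolve_right fun h' => hmin _ h' ?_
  rw [Fin.lt_def]
  simp
  omega

/-- The sum of the (zero-based) labels of the columns. -/
def colSum (T : PermutationTableau n) : ℕ := ∑ k, if T.south k = true then 0 else k.val

theorem AddCorner.colSum_lt {S T : PermutationTableau n} {i i' : Fin n} (h : S.AddCorner T i i') :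
    S.colSum < T.colSum := by
  have hT : T.colSum = ∑ k, if S.south k = true then 0 else (swap i i' k).val := by
    rw [colSum, ← Equiv.sum_comp (swap i i')]
    simp only [h.2.2.2.1, swap_apply_self]
  rw [hT, colSum]
  apply Finset.sum_lt_sum
  · intro k _
    split_ifs with hk
    · exact le_rfl
    · have : k ≠ i' := by rintro rfl; exact hk h.2.2.1
      rw [swap_apply_def, if_neg this]
      split_ifs with h1
      · rw [h1, h.1]; omega
      · exact le_rfl
  · refine ⟨i, Finset.mem_univ _, ?_⟩
    have : ¬ S.south i = true := fun hs => IsRow.not_isCol hs h.2.1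
    rw [if_neg this, if_neg this, swap_apply_left, h.1]
    omega

/-- At any corner, the three cases of `corner_cases` permit deleting a zero row, deleting a column,
or removing a box. The deletions lower the half-perimeter; removing a box keeps it but lowers
`colSum`, hence the nested induction. -/
theorem induction_on {motive : ∀ n, PermutationTableau n → Prop}
    (rows : ∀ n (T : PermutationTableau n), (∀ k, T.IsRow k) → motive n T)
    (zeroRow : ∀ N (T : PermutationTableau (N + 1)) (D : PermutationTableau N) (r : Fin (N + 1)),
      1 ≤ r.val → T.IsDeletion r D → T.IsRow r → (∀ j, T.one r j = false) → motive N D →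
        motive (N + 1) T)
    (necessaryCorner : ∀ N (T : PermutationTableau (N + 1)) (D : PermutationTableau N)
      (i r : Fin (N + 1)), T.IsDeletion r D → T.IsNecessaryCorner i r → motive N D →
        motive (N + 1) T)
    (addCorner : ∀ n (S T : PermutationTableau n) (i i' : Fin n), S.AddCorner T i i' →
      motive n S → motive n T)
    (n : ℕ) (T : PermutationTableau n) : motive n T := by
  induction n with
  | zero => exact rows 0 T fun k => k.elim0
  | succ N ihN =>
    induction hm : T.colSum using Nat.strong_induction_on generalizing T with
    | _ m ihm =>
    by_cases hcol : ∃ k, T.IsCol k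
    · obtain ⟨i, i', h, hi, hi'⟩ := T.exists_corner hcol
      rcases T.corner_cases h hi hi' with ⟨hi1, -, hz⟩ | hc | ⟨hone, h1⟩
      · exact zeroRow N T _ i hi1 (T.isDeletion_deleteLine i hi1 fun _ => hz) hi hz (ihN _)
      · exact necessaryCorner N T _ i i' (T.isDeletion_deleteLine i' (by omega)
          fun hr => absurd hi' hr.not_isCol) hc (ihN _)
      · have hA := T.addCorner_removeCorner i i' h hi hi' h1 hone
        exact addCorner _ _ T i i' hA (ihm _ (hm ▸ hA.colSum_lt) _ rfl)
    · refine rows _ T fun k => (T.isRow_or_isCol k).resolve_right fun hk => hcol ⟨k, hk⟩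

theorem one_eq_false_of_rows {T : PermutationTableau n} (h : ∀ k, T.IsRow k) (i j : Fin n) :
    T.one i j = false :=
  one_col_eq_false (h j) i

/-! ### The map to permutations -/

/-- The permutation that sends `r` to `i` and acts on the other labels as `κ`, except that `r` takes
the place of the value `i`. -/
theorem exists_perm_insert (r i : Fin (N + 1)) (κ : Perm (Fin N)) : ∃ π : Perm (Fin (N + 1)),
    π r = i ∧ ∀ k, π (r.succAbove k) = swap i r (r.succAbove (κ k)) := by
  let π : Fin (N + 1) → Fin (N + 1) :=
    Fin.insertNth (α := fun _ => Fin (N + 1)) r i fun k => swap i r (r.succAbove (κ k))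
  have h1 : π r = i := by simp [π]
  have h2 : ∀ k, π (r.succAbove k) = swap i r (r.succAbove (κ k)) := by simp [π]
  have hπ : Function.Injective π := by
    intro x y hxy
    rcases Fin.eq_self_or_eq_succAbove r x with hx | ⟨x, rfl⟩ <;>
    rcases Fin.eq_self_or_eq_succAbove r y with hy | ⟨y, rfl⟩
    · exact hx.trans hy.symm
    · rw [hx, h1, h2, eq_comm, swap_apply_eq_iff, swap_apply_left] at hxy
      exact absurd hxy (Fin.succAbove_ne _ _)
    · rw [hy, h1, h2, swap_apply_eq_iff, swap_apply_left] at hxy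
      exact absurd hxy (Fin.succAbove_ne _ _)
    · rw [h2, h2] at hxy
      simpa using hxy
  exact ⟨Equiv.ofBijective π (Finite.injective_iff_bijective.1 hπ), h1, h2⟩

/-- That every path ends and that the ends form a permutation is proved in one induction: each
operation turns the permutation of the smaller tableau into an explicit new one. -/
theorem exists_phi (n : ℕ) (T : PermutationTableau n) :
    ∃ π : Perm (Fin n), ∀ x, T.ZigzagEnd x (π x) := by
  induction n, T using induction_on with
  | rows n T h => exact ⟨1, fun x => .zero_row _ (h x) fun j => one_eq_false_of_rows h x j⟩
  | zeroRow N T D r _ hD hr hz ih =>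
    obtain ⟨κ, hκ⟩ := ih
    -- With `i = r` the swap is trivial, so this adds a fixed point.
    obtain ⟨π, h1, h2⟩ := exists_perm_insert r r κ
    refine ⟨π, fun x => ?_⟩
    rcases Fin.eq_self_or_eq_succAbove r x with rfl | ⟨y, rfl⟩
    · rw [h1]; exact .zero_row _ hr hz
    · rw [h2, swap_self]; exact hD.zigzagEnd_zeroRow hz hr (hκ y)
  | necessaryCorner N T D i r hD hc ih =>
    obtain ⟨κ, hκ⟩ := ih
    obtain ⟨π, h1, h2⟩ := exists_perm_insert r i κ
    refine ⟨π, fun x => ?_⟩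
    rcases Fin.eq_self_or_eq_succAbove r x with rfl | ⟨y, rfl⟩
    · rw [h1]; exact hc.zigzagEnd
    · rw [h2]; exact hD.zigzagEnd_necessaryCorner hc (hκ y)
  | addCorner n S T i i' hA ih =>
    obtain ⟨π, hπ⟩ := ih
    refine ⟨π * swap i i', fun x => ?_⟩
    have := hA.zigzagEnd (hπ (swap i i' x))
    rwa [swap_apply_self] at this

/-- The permutation of the labels given by the zig-zag paths of a tableau. -/
noncomputable def phi (T : PermutationTableau n) : Perm (Fin n) := (exists_phi n T).choose

theorem zigzagEnd_phi (T : PermutationTableau n) (x : Fin n) : T.ZigzagEnd x (T.phi x) :=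
  (exists_phi n T).choose_spec x

theorem ZigzagEnd.phi_eq {T : PermutationTableau n} {x k : Fin n} (h : T.ZigzagEnd x k) :
    T.phi x = k :=
  (T.zigzagEnd_phi x).unique h

theorem isRow_iff_le_phi (T : PermutationTableau n) (x : Fin n) : T.IsRow x ↔ x ≤ T.phi x := by
  refine ⟨fun h => (T.zigzagEnd_phi x).le_of_isRow h, fun h => ?_⟩
  exact (T.isRow_or_isCol x).resolve_right fun h' =>
    ((T.zigzagEnd_phi x).lt_of_isCol h').not_ge h

theorem isCol_iff_phi_lt (T : PermutationTableau n) (x : Fin n) : T.IsCol x ↔ T.phi x < x := by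
  rw [isCol_iff_not_isRow, isRow_iff_le_phi, not_le]

theorem zeroRow_of_phi_eq {T : PermutationTableau n} {x : Fin n} (h : T.phi x = x) (j : Fin n) :
    T.one x j = false :=
  ZigzagEnd.zero_of_isRow (by simpa [h] using T.zigzagEnd_phi x)
    ((T.isRow_iff_le_phi x).2 h.ge) j

theorem phi_eq_of_zeroRow {T : PermutationTableau n} {r : Fin n} (hr : T.IsRow r)
    (hz : ∀ j, T.one r j = false) : T.phi r = r :=
  (ZigzagEnd.zero_row r hr hz).phi_eq

theorem IsDeletion.phi_zeroRow {T : PermutationTableau (N + 1)} {D : PermutationTableau N}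
    {r : Fin (N + 1)} (h : T.IsDeletion r D) (hr : T.IsRow r) (hz : ∀ j, T.one r j = false)
    (k : Fin N) : T.phi (r.succAbove k) = r.succAbove (D.phi k) :=
  (h.zigzagEnd_zeroRow hz hr (D.zigzagEnd_phi k)).phi_eq

theorem IsNecessaryCorner.phi_eq {T : PermutationTableau n} {i r : Fin n}
    (hc : T.IsNecessaryCorner i r) : T.phi r = i :=
  hc.zigzagEnd.phi_eq

theorem IsDeletion.phi_necessaryCorner {T : PermutationTableau (N + 1)} {D : PermutationTableau N}
    {i r : Fin (N + 1)} (h : T.IsDeletion r D) (hc : T.IsNecessaryCorner i r) (k : Fin N) :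
    T.phi (r.succAbove k) = swap i r (r.succAbove (D.phi k)) :=
  (h.zigzagEnd_necessaryCorner hc (D.zigzagEnd_phi k)).phi_eq

theorem AddCorner.phi_eq {S T : PermutationTableau n} {i i' : Fin n} (h : S.AddCorner T i i') :
    T.phi = S.phi * swap i i' := by
  ext1 x
  have := (h.zigzagEnd (S.zigzagEnd_phi (swap i i' x))).phi_eq
  rwa [swap_apply_self] at this

/-- Removing the box exchanges the roles of row and column: before the swap `i'` is a row and `i` a
column, so their images are at least `i'` and less than `i`. Thus the permutation distinguishes this
case from the other two. -/
theorem corner_superfluous {T : PermutationTableau n} {i i' : Fin n} (h : i'.val = i.val + 1)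
    (hi : T.IsRow i) (hi' : T.IsCol i') (hone : T.one i i' = true)
    (h1 : ∃ k, k < i ∧ T.one k i' = true) : i < T.phi i ∧ T.phi i' < i := by
  have hA := T.addCorner_removeCorner i i' h hi hi' h1 hone
  set S := T.removeCorner i i' h hi hi' h1
  rw [hA.phi_eq]
  simp only [Perm.mul_apply, swap_apply_left, swap_apply_right]
  have h2 := (S.isCol_iff_phi_lt i).1 hA.2.1
  have h3 := (S.isRow_iff_le_phi i').1 hA.2.2.1
  refine ⟨lt_of_lt_of_le ?_ h3, h2⟩
  rw [Fin.lt_def]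
  omega

theorem isNecessaryCorner_of_phi_eq {T : PermutationTableau n} {i i' : Fin n}
    (h : i'.val = i.val + 1) (hi : T.IsRow i) (hphi : T.phi i' = i) :
    T.IsNecessaryCorner i i' := by
  have hlt : i < i' := by rw [Fin.lt_def]; omega
  have hi' : T.IsCol i' := (T.isCol_iff_phi_lt i').2 (hphi.trans_lt hlt)
  rcases T.corner_cases h hi hi' with ⟨hi1, -, hz⟩ | hc | ⟨hone, h1⟩
  · have := T.phi.injective (hphi.trans (phi_eq_of_zeroRow hi hz).symm)
    exact absurd this hlt.ne'
  · exact hc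
  · exact absurd hphi (corner_superfluous h hi hi' hone h1).2.ne

theorem AddCorner.right_unique {S T T' : PermutationTableau n} {i i' : Fin n}
    (h : S.AddCorner T i i') (h' : S.AddCorner T' i i') : T = T' := by
  apply PermutationTableau.ext
  · funext k
    rw [h.2.2.2.1, h'.2.2.2.1]
  · funext k l
    rw [Bool.eq_iff_iff, h.2.2.2.2, h'.2.2.2.2]

theorem IsDeletion.eq_of_zeroRow {T T' : PermutationTableau (N + 1)} {D : PermutationTableau N}
    {r : Fin (N + 1)} (h : T.IsDeletion r D) (hr : T.IsRow r) (hz : ∀ j, T.one r j = false)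
    (h' : T'.IsDeletion r D) (hr' : T'.IsRow r) (hz' : ∀ j, T'.one r j = false) : T = T' := by
  apply PermutationTableau.ext
  · funext k
    rcases Fin.eq_self_or_eq_succAbove r k with rfl | ⟨y, rfl⟩
    · exact hr.trans hr'.symm
    · rw [h.1, h'.1]
  · funext k l
    rcases Fin.eq_self_or_eq_succAbove r k with rfl | ⟨x, rfl⟩
    · rw [hz, hz']
    rcases Fin.eq_self_or_eq_succAbove r l with rfl | ⟨y, rfl⟩
    · rw [one_col_eq_false hr, one_col_eq_false hr']
    · rw [h.2, h'.2]

theorem IsDeletion.eq_of_necessaryCorner {T T' : PermutationTableau (N + 1)}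
    {D : PermutationTableau N} {i r : Fin (N + 1)} (h : T.IsDeletion r D)
    (hc : T.IsNecessaryCorner i r) (h' : T'.IsDeletion r D) (hc' : T'.IsNecessaryCorner i r) :
    T = T' := by
  apply PermutationTableau.ext
  · funext k
    rcases Fin.eq_self_or_eq_succAbove r k with rfl | ⟨y, rfl⟩
    · exact hc.2.2.1.trans hc'.2.2.1.symm
    · rw [h.1, h'.1]
  · funext k l
    rcases Fin.eq_self_or_eq_succAbove r k with rfl | ⟨x, rfl⟩
    · rw [one_row_eq_false hc.2.2.1, one_row_eq_false hc'.2.2.1]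
    rcases Fin.eq_self_or_eq_succAbove r l with rfl | ⟨y, rfl⟩
    · rw [Bool.eq_iff_iff, hc.2.2.2, hc'.2.2.2]
    · rw [h.2, h'.2]

/-- The permutation fixes the border (rows are weak excedances) and tells which operation produced
`T`. So the same operation can be undone in `T'`, and the two smaller tableaux again have equal
permutations. -/
theorem eq_of_phi_eq (n : ℕ) (T : PermutationTableau n) :
    ∀ T' : PermutationTableau n, T.phi = T'.phi → T = T' := by
  induction n, T using induction_on with
  | rows n T h =>
    intro T' hT
    have h' : ∀ k, T'.IsRow k := fun k => by
      rw [isRow_iff_le_phi, ← hT, ← isRow_iff_le_phi]; exact h k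
    apply PermutationTableau.ext
    · funext k; exact (h k).trans (h' k).symm
    · funext k l
      rw [one_eq_false_of_rows h, one_eq_false_of_rows h']
  | zeroRow N T D r hr1 hD hr hz ih =>
    intro T' hT
    have hr' : T'.phi r = r := hT ▸ phi_eq_of_zeroRow hr hz
    have hz' := zeroRow_of_phi_eq hr'
    have hrow := (T'.isRow_iff_le_phi r).2 hr'.ge
    have hD' := T'.isDeletion_deleteLine r hr1 fun _ => hz'
    have : D = _ := ih (T'.deleteLine r hr1 fun _ => hz') <| by
      ext1 k
      have := hD.phi_zeroRow hr hz k
      rw [hT, hD'.phi_zeroRow hrow hz', Fin.succAbove_right_inj] at this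
      exact this.symm
    exact hD.eq_of_zeroRow hr hz (this ▸ hD') hrow hz'
  | necessaryCorner N T D i r hD hc ih =>
    intro T' hT
    have hrow : T'.IsRow i := by rw [isRow_iff_le_phi, ← hT, ← isRow_iff_le_phi]; exact hc.2.1
    have hc' := isNecessaryCorner_of_phi_eq hc.1 hrow (hT ▸ hc.phi_eq)
    have hD' := T'.isDeletion_deleteLine r (by rw [hc.1]; omega)
      fun hr => absurd hc'.2.2.1 hr.not_isCol
    have : D = _ := ih (T'.deleteLine r (by rw [hc.1]; omega)
        fun hr => absurd hc'.2.2.1 hr.not_isCol) <| by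
      ext1 k
      have := hD.phi_necessaryCorner hc k
      rw [hT, hD'.phi_necessaryCorner hc', (swap i r).injective.eq_iff,
        Fin.succAbove_right_inj] at this
      exact this.symm
    exact hD.eq_of_necessaryCorner hc (this ▸ hD') hc'
  | addCorner n S T i i' hA ih =>
    intro T' hT
    have hi : T.IsRow i := by simpa using hA.isRow_swap.2 hA.2.2.1
    have hi' : T.IsCol i' := by simpa using hA.isCol_swap.2 hA.2.1
    have hrow : T'.IsRow i := by rw [isRow_iff_le_phi, ← hT, ← isRow_iff_le_phi]; exact hi
    have hcol : T'.IsCol i' := by rw [isCol_iff_phi_lt, ← hT, ← isCol_iff_phi_lt]; exact hi'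
    have hne : i < T.phi i ∧ T.phi i' < i := by
      rw [hA.phi_eq]
      simp only [Perm.mul_apply, swap_apply_left, swap_apply_right]
      refine ⟨lt_of_lt_of_le ?_ ((S.isRow_iff_le_phi i').1 hA.2.2.1),
        (S.isCol_iff_phi_lt i).1 hA.2.1⟩
      rw [Fin.lt_def, hA.1]
      omega
    rcases T'.corner_cases hA.1 hrow hcol with ⟨-, -, hz⟩ | hc | ⟨hone, h1⟩
    · exact absurd (hT ▸ phi_eq_of_zeroRow hrow hz) hne.1.ne'
    · exact absurd (hT ▸ hc.phi_eq) hne.2.ne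
    · have hA' := T'.addCorner_removeCorner i i' hA.1 hrow hcol h1 hone
      have : S = _ := ih (T'.removeCorner i i' hA.1 hrow hcol h1) <| by
        have := hA.phi_eq
        rw [hT, hA'.phi_eq] at this
        exact (mul_right_cancel this).symm
      rw [← this] at hA'
      exact hA.right_unique hA'

theorem phi_injective : Function.Injective (phi : PermutationTableau n → Perm (Fin n)) :=
  fun T T' h => eq_of_phi_eq n T T' h

theorem val_succAbove (q : Fin (N + 1)) (k : Fin N) :
    (q.succAbove k).val = if k.val < q.val then k.val else k.val + 1 := by
  simp only [Fin.succAbove, Fin.lt_def]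
  split_ifs <;> simp_all

/-! ### Collapsing a permutation -/

/-- `κ` is the collapse of `π` at `p`, with the remaining labels renamed. -/
def IsCollapse (π : Perm (Fin (N + 1))) (p : Fin (N + 1)) (κ : Perm (Fin N)) : Prop :=
  ∀ k, p.succAbove (κ k) = swap p (π p) (π (p.succAbove k))

theorem exists_isCollapse (π : Perm (Fin (N + 1))) (p : Fin (N + 1)) : ∃ κ, IsCollapse π p κ := by
  have h : ∀ k : Fin N, ∃ l, p.succAbove l = swap p (π p) (π (p.succAbove k)) := fun k => by
    apply Fin.exists_succAbove_eq
    rw [Ne, swap_apply_eq_iff, swap_apply_left, π.injective.eq_iff]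
    exact Fin.succAbove_ne _ _
  choose f hf using h
  have hinj : Function.Injective f := fun k l hkl => by
    have := congrArg p.succAbove hkl
    rw [hf, hf] at this
    simpa using this
  exact ⟨Equiv.ofBijective f (Finite.injective_iff_bijective.1 hinj), hf⟩

theorem IsDeletion.isCollapse_zeroRow {T : PermutationTableau (N + 1)} {D : PermutationTableau N}
    {r : Fin (N + 1)} (h : T.IsDeletion r D) (hr : T.IsRow r) (hz : ∀ j, T.one r j = false) :
    IsCollapse T.phi r D.phi := fun k => by
  rw [phi_eq_of_zeroRow hr hz, swap_self, h.phi_zeroRow hr hz]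
  rfl

/-- Collapsing at `r` replaces the value `r` by the image `i` of `r`, which undoes the substitution
made when the column was inserted. -/
theorem IsDeletion.isCollapse_necessaryCorner {T : PermutationTableau (N + 1)}
    {D : PermutationTableau N} {i r : Fin (N + 1)} (h : T.IsDeletion r D)
    (hc : T.IsNecessaryCorner i r) : IsCollapse T.phi r D.phi := fun k => by
  rw [hc.phi_eq, h.phi_necessaryCorner hc, swap_comm, swap_apply_self]

/-! ### Surjectivity -/

/-- The counterpart of `exists_corner`. Without non-excedances, `k ≤ π k` for all `k`, and equality
of the sums forces the identity; the least non-excedance follows a weak excedance. -/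
theorem exists_descent {π : Perm (Fin n)} (h : π ≠ 1) :
    ∃ i i' : Fin n, i'.val = i.val + 1 ∧ i ≤ π i ∧ π i' < i' := by
  have hex : ∃ k, π k < k := by
    by_contra hc
    push Not at hc
    refine h ?_
    ext1 k
    by_contra hk
    have hlt : ∑ k : Fin n, k.val < ∑ k : Fin n, (π k).val := by
      refine Finset.sum_lt_sum (fun k _ => Fin.le_def.1 (hc k)) ?_
      exact ⟨k, Finset.mem_univ _, lt_of_le_of_ne (hc k) fun e => hk (Fin.ext e.symm)⟩
    rw [Equiv.sum_comp π (fun k : Fin n => k.val)] at hlt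
    exact lt_irrefl _ hlt
  obtain ⟨c, hc, hmin⟩ := WellFounded.has_min (wellFounded_lt (α := Fin n)) {k | π k < k} hex
  have hc0 : c.val ≠ 0 := fun h0 => by
    have : (π c).val < c.val := hc
    omega
  refine ⟨⟨c.val - 1, by omega⟩, c, by simp; omega, ?_, hc⟩
  refine not_lt.1 fun h' => hmin _ h' ?_
  rw [Fin.lt_def]
  simp
  omega

/-- The sum of the (zero-based) non-excedances of a permutation. -/
def nonexcSum (π : Perm (Fin n)) : ℕ := ∑ k, if π k < k then k.val else 0

theorem nonexcSum_mul_swap_lt {π : Perm (Fin n)} {i i' : Fin n} (h : i'.val = i.val + 1)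
    (hi : i < π i) (hi' : π i' < i) : nonexcSum (π * swap i i') < nonexcSum π := by
  have hlt : i < i' := by rw [Fin.lt_def]; omega
  -- The non-excedances of the product are the images under the swap of those of `π`: the only
  -- change is that `i'` moves down to `i`.
  have hval : ∀ k, (if (π * swap i i') (swap i i' k) < swap i i' k then (swap i i' k).val else 0)
      = if π k < k then (swap i i' k).val else 0 := by
    intro k
    rw [Perm.mul_apply, swap_apply_self]
    congr 1
    rw [eq_iff_iff]
    rcases eq_or_ne k i with rfl | h1
    · rw [swap_apply_left]
      simp only [Fin.lt_def] at *
      omega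
    rcases eq_or_ne k i' with rfl | h2
    · rw [swap_apply_right]
      exact ⟨fun _ => hi'.trans hlt, fun _ => hi'⟩
    · rw [swap_apply_of_ne_of_ne h1 h2]
  rw [nonexcSum, ← Equiv.sum_comp (swap i i')]
  simp only [hval]
  rw [nonexcSum]
  apply Finset.sum_lt_sum
  · intro k _
    split_ifs with hk
    · rcases eq_or_ne k i with rfl | h1
      · exact absurd hk hi.not_gt
      rcases eq_or_ne k i' with rfl | h2
      · rw [swap_apply_right]; exact hlt.le
      · rw [swap_apply_of_ne_of_ne h1 h2]
    · exact le_rfl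
  · refine ⟨i', Finset.mem_univ _, ?_⟩
    rw [if_pos (hi'.trans hlt), if_pos (hi'.trans hlt), swap_apply_right]
    exact hlt

theorem phi_of_rows {T : PermutationTableau n} (h : ∀ k, T.IsRow k) : T.phi = 1 := by
  ext1 k
  exact phi_eq_of_zeroRow (h k) (one_eq_false_of_rows h k)

/-- Mirrors `induction_on` at a descent `i`, `i'`: insert a zero row if `π i = i`, a column if `π i'
= i`, and a corner box otherwise. `nonexcSum` plays the part of `colSum`. -/
theorem exists_phi_eq (n : ℕ) (π : Perm (Fin n)) : ∃ T : PermutationTableau n, T.phi = π := by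
  induction n with
  | zero =>
    exact ⟨⟨fun _ => true, fun _ _ => false, by simp, by simp, by simp, by simp⟩,
      Subsingleton.elim _ _⟩
  | succ N ihN =>
    induction hm : nonexcSum π using Nat.strong_induction_on generalizing π with
    | _ m ihm =>
    by_cases h1 : π = 1
    · exact ⟨⟨fun _ => true, fun _ _ => false, by simp, by simp, by simp, by simp⟩,
        (phi_of_rows fun k => by rfl).trans h1.symm⟩
    obtain ⟨i, i', h, hi, hi'⟩ := exists_descent h1
    have hlt : i < i' := by rw [Fin.lt_def]; omega
    rcases hi.eq_or_lt with hi | hi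
    · obtain ⟨κ, hκ⟩ := exists_isCollapse π i
      obtain ⟨D, rfl⟩ := ihN κ
      refine ⟨D.insertRow i, ?_⟩
      ext1 k
      rcases Fin.eq_self_or_eq_succAbove i k with rfl | ⟨k, rfl⟩
      · rw [phi_eq_of_zeroRow (D.isRow_insertRow _) (D.insertRow_zero _)]
        exact hi
      · rw [(D.isDeletion_insertRow i).phi_zeroRow (D.isRow_insertRow _) (D.insertRow_zero _), hκ,
          ← hi, swap_self]
        rfl
    rcases (show π i' ≤ i by rw [Fin.lt_def] at hi'; rw [Fin.le_def]; omega).eq_or_lt with hii | hii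
    · obtain ⟨κ, hκ⟩ := exists_isCollapse π i'
      obtain ⟨D, rfl⟩ := ihN κ
      obtain ⟨j, rfl⟩ : ∃ j : Fin N, i = j.castSucc :=
        ⟨⟨i.val, by omega⟩, rfl⟩
      obtain rfl : i' = j.succ := Fin.ext h
      -- The collapse at `i'` sends `i` to `π i`, or to `i` itself when `π i = i'`; either way `i`
      -- stays a weak excedance, so the column can be inserted after that row.
      have hj : D.IsRow j := by
        rw [isRow_iff_le_phi, ← Fin.succAbove_le_succAbove_iff (p := j.succ), hκ, hii,
          Fin.succAbove_succ_self]
        rcases eq_or_ne (π j.castSucc) j.succ with h2 | h2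
        · rw [h2, swap_apply_left]
        · rw [swap_apply_of_ne_of_ne h2 hi.ne']
          exact hi.le
      have hc := D.isNecessaryCorner_insertCol j hj
      refine ⟨D.insertCol j hj, ?_⟩
      ext1 k
      rcases Fin.eq_self_or_eq_succAbove j.succ k with rfl | ⟨k, rfl⟩
      · rw [hc.phi_eq, hii]
      · rw [(D.isDeletion_insertCol j hj).phi_necessaryCorner hc, hκ, hii, swap_comm,
          swap_apply_self]
    · obtain ⟨S, hS⟩ := ihm _ (hm ▸ nonexcSum_mul_swap_lt h hi hii) (π * swap i i') rfl
      have hcol : S.IsCol i := by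
        rw [isCol_iff_phi_lt, hS, Perm.mul_apply, swap_apply_left]; exact hii
      have hrow : S.IsRow i' := by
        rw [isRow_iff_le_phi, hS, Perm.mul_apply, swap_apply_right, Fin.le_def]
        rw [Fin.lt_def] at hi
        omega
      refine ⟨_, (S.addCorner_addCorner i i' h hcol hrow).phi_eq.trans ?_⟩
      rw [hS, mul_assoc, swap_mul_self, mul_one]

/-- The bijection from permutation tableaux to permutations. -/
noncomputable def phiEquiv (n : ℕ) : PermutationTableau n ≃ Perm (Fin n) :=
  Equiv.ofBijective phi ⟨phi_injective, exists_phi_eq n⟩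

theorem phiEquiv_apply (T : PermutationTableau n) : phiEquiv n T = T.phi := rfl

end PermutationTableau

namespace PermChain

open PermutationTableau

variable {n N : ℕ}

/-! ### Normalization -/

theorem norm_eq_of_forall {S : Finset ℚ} (h : S.card = n) (σ : Perm S) (τ : Perm (Fin n))
    (hτ : ∀ x, σ (S.orderIsoOfFin h x) = S.orderIsoOfFin h (τ x)) : norm h σ = τ := by
  ext1 x
  simp only [norm, Equiv.permCongr_apply]
  change (S.orderIsoOfFin h).symm (σ (S.orderIsoOfFin h x)) = τ x
  rw [hτ, OrderIso.symm_apply_apply]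

theorem lab_strictMono : StrictMono (lab : Fin n → ℚ) := fun a b hab => by
  simp only [lab]
  rw [Fin.lt_def] at hab
  gcongr

theorem orderIsoOfFin_labels (x : Fin n) : ((labels n).orderIsoOfFin card_labels x : ℚ) = lab x := by
  rw [Finset.coe_orderIsoOfFin_apply]
  have := Finset.orderEmbOfFin_unique (s := labels n) card_labels (f := lab) lab_mem
    lab_strictMono
  exact (congrFun this x).symm

theorem ofSubtype_onLabels (π : Perm (Fin n)) (x : Fin n) :
    Perm.ofSubtype (onLabels π) (lab x) = lab (π x) := by
  rw [Perm.ofSubtype_apply_of_mem _ (lab_mem x)]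
  have : (⟨lab x, lab_mem x⟩ : labels n) = (labels n).orderIsoOfFin card_labels x :=
    Subtype.ext (orderIsoOfFin_labels x).symm
  rw [this, onLabels, Equiv.permCongr_apply]
  change ((labels n).orderIsoOfFin card_labels
    (π (((labels n).orderIsoOfFin card_labels).symm _)) : ℚ) = _
  rw [OrderIso.symm_apply_apply, orderIsoOfFin_labels]

theorem half_lt_lab {x : Fin n} {m : ℕ} (h : m ≤ x.val) : (m + 1 / 2 : ℚ) < lab x := by
  have : (m : ℚ) ≤ x.val := by exact_mod_cast h
  rw [lab]
  linarith

theorem lab_lt_half {x : Fin n} {m : ℕ} (h : x.val + 1 ≤ m) : lab x < (m + 1 / 2 : ℚ) := by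
  have : (x.val + 1 : ℚ) ≤ m := by exact_mod_cast h
  rw [lab]
  linarith

/-- The elements of `({1, …, n} \ {p}) ∪ {m + 1/2}` in increasing order, where `m + 1/2` comes at
position `r`. -/
theorem orderIsoOfFin_replace (p r : Fin (N + 1)) (m : ℕ)
    (hr : r.val = if p.val + 1 ≤ m then m - 1 else m) (x : Fin (N + 1)) :
    ((insert (m + 1 / 2 : ℚ) ((labels (N + 1)).erase (lab p))).orderIsoOfFin (card_replace p m) x : ℚ)
      = Fin.insertNth (α := fun _ => ℚ) r (m + 1 / 2 : ℚ) (fun k => lab (p.succAbove k)) x := by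
  rw [Finset.coe_orderIsoOfFin_apply]
  -- A strictly increasing enumeration is unique. The position `r` counts the elements below `m +
  -- 1/2`: the labels `1, …, m`, without the deleted one `p + 1` if it is among them.
  have h := Finset.orderEmbOfFin_unique (card_replace p m)
    (f := Fin.insertNth (α := fun _ => ℚ) r (m + 1 / 2 : ℚ) (fun k => lab (p.succAbove k))) ?_ ?_
  · exact (congrFun h x).symm
  · intro x
    rcases Fin.eq_self_or_eq_succAbove r x with rfl | ⟨y, rfl⟩
    · simp
    · rw [Fin.insertNth_apply_succAbove]
      exact Finset.mem_insert_of_mem (Finset.mem_erase.2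
        ⟨fun e => Fin.succAbove_ne _ _ (lab_injective e), lab_mem _⟩)
  · intro x y hxy
    rcases Fin.eq_self_or_eq_succAbove r x with hx | ⟨x, rfl⟩ <;>
    rcases Fin.eq_self_or_eq_succAbove r y with hy | ⟨y, rfl⟩
    · exact absurd (hx.trans hy.symm) hxy.ne
    · rw [hx, Fin.insertNth_apply_same, Fin.insertNth_apply_succAbove]
      apply half_lt_lab
      rw [hx, Fin.lt_def] at hxy
      simp only [val_succAbove] at *
      split_ifs at * <;> omega
    · rw [hy, Fin.insertNth_apply_same, Fin.insertNth_apply_succAbove]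
      apply lab_lt_half
      rw [hy, Fin.lt_def] at hxy
      simp only [val_succAbove] at *
      split_ifs at * <;> omega
    · rw [Fin.insertNth_apply_succAbove, Fin.insertNth_apply_succAbove]
      apply lab_strictMono
      rwa [Fin.succAbove_lt_succAbove_iff] at hxy ⊢

theorem orderIsoOfFin_replace_same (p r : Fin (N + 1)) (m : ℕ)
    (hr : r.val = if p.val + 1 ≤ m then m - 1 else m) :
    (insert (m + 1 / 2 : ℚ) ((labels (N + 1)).erase (lab p))).orderIsoOfFin (card_replace p m) r
      = ⟨(m + 1 / 2 : ℚ), Finset.mem_insert_self _ _⟩ := by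
  apply Subtype.ext
  rw [orderIsoOfFin_replace p r m hr, Fin.insertNth_apply_same]

theorem orderIsoOfFin_replace_succAbove (p r : Fin (N + 1)) (m : ℕ)
    (hr : r.val = if p.val + 1 ≤ m then m - 1 else m) (k : Fin N) :
    ((insert (m + 1 / 2 : ℚ) ((labels (N + 1)).erase (lab p))).orderIsoOfFin (card_replace p m)
      (r.succAbove k) : ℚ) = lab (p.succAbove k) := by
  rw [orderIsoOfFin_replace p r m hr, Fin.insertNth_apply_succAbove]

theorem lab_mem_erase (p : Fin (N + 1)) (k : Fin N) :
    lab (p.succAbove k) ∈ (labels (N + 1)).erase (lab p) :=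
  Finset.mem_erase.2 ⟨fun e => Fin.succAbove_ne _ _ (lab_injective e), lab_mem _⟩

theorem lab_swap (a b x : Fin n) : lab (swap a b x) = swap (lab a) (lab b) (lab x) := by
  rcases eq_or_ne x a with rfl | h1
  · simp
  rcases eq_or_ne x b with rfl | h2
  · simp
  rw [swap_apply_of_ne_of_ne h1 h2, swap_apply_of_ne_of_ne (lab_injective.ne h1)
    (lab_injective.ne h2)]

theorem collapse_onLabels {π : Perm (Fin (N + 1))} {p : Fin (N + 1)} {κ : Perm (Fin N)}
    (h : IsCollapse π p κ) (k : Fin N) :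
    (collapse (onLabels π) (lab p) ⟨lab (p.succAbove k), lab_mem_erase p k⟩ : ℚ) =
      lab (p.succAbove (κ k)) := by
  rw [h, lab_swap, ← ofSubtype_onLabels, ← ofSubtype_onLabels]
  rfl

theorem addFixedPoint_self {S : Finset ℚ} (σ : Perm S) {a : ℚ} (ha : a ∉ S) :
    (addFixedPoint σ a ⟨a, Finset.mem_insert_self a S⟩ : ℚ) = a :=
  Perm.ofSubtype_apply_of_not_mem σ ha

theorem addFixedPoint_of_mem {S : Finset ℚ} (σ : Perm S) {a x : ℚ} (hx : x ∈ S)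
    (hx' : x ∈ insert a S) : (addFixedPoint σ a ⟨x, hx'⟩ : ℚ) = σ ⟨x, hx⟩ :=
  Perm.ofSubtype_apply_of_mem σ hx

theorem half_notMem_erase (p : Fin n) (m : ℕ) : (m + 1 / 2 : ℚ) ∉ (labels n).erase (lab p) :=
  fun h => half_notMem m (Finset.mem_of_mem_erase h)

/-- Translates half-integer labels and normalization into insertion at a position `r`, the form in
which `phi` of a tableau with a new zero row is known. -/
theorem collapseAddFixed_eq {π τ : Perm (Fin (N + 1))} {p r : Fin (N + 1)} {m : ℕ}
    {κ : Perm (Fin N)} (h : IsCollapse π p κ)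
    (hr : r.val = if p.val + 1 ≤ m then m - 1 else m) (hτ : τ r = r)
    (hτ' : ∀ k, τ (r.succAbove k) = r.succAbove (κ k)) : collapseAddFixed π p m = τ := by
  apply norm_eq_of_forall
  intro x
  rcases Fin.eq_self_or_eq_succAbove r x with hx | ⟨k, rfl⟩
  · rw [hx, hτ, orderIsoOfFin_replace_same p r m hr]
    exact Subtype.ext (addFixedPoint_self _ (half_notMem_erase p m))
  · apply Subtype.ext
    rw [hτ', orderIsoOfFin_replace_succAbove p r m hr, ← collapse_onLabels h,
      ← addFixedPoint_of_mem (a := (m + 1 / 2 : ℚ)) _ (lab_mem_erase p k)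
        (Finset.mem_insert_of_mem (lab_mem_erase p k))]
    congr 2
    exact Subtype.ext (orderIsoOfFin_replace_succAbove p r m hr k)

theorem collapseInsertBefore_eq {π τ : Perm (Fin (N + 1))} {p r j : Fin (N + 1)} (hj : j ≠ p)
    {κ : Perm (Fin N)} (h : IsCollapse π p κ) (hjp : j < p) (hr : r.val = j.val + 1)
    (hτ : τ r = j) (hτ' : ∀ k, τ (r.succAbove k) = swap j r (r.succAbove (κ k))) :
    collapseInsertBefore π p j hj = τ := by
  have hr' : r.val = if p.val + 1 ≤ j.val + 1 then j.val + 1 - 1 else j.val + 1 := by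
    rw [Fin.lt_def] at hjp
    rw [if_neg (by omega), hr]
  -- The label `j` precedes both the deleted and the inserted one, so neither shifts it.
  obtain ⟨j₀, hj₀, hj₀'⟩ : ∃ j₀ : Fin N, p.succAbove j₀ = j ∧ r.succAbove j₀ = j := by
    rw [Fin.lt_def] at hjp
    have hp := p.isLt
    refine ⟨⟨j.val, by omega⟩, ?_, ?_⟩
    · rw [Fin.succAbove_of_castSucc_lt _ _ (by rw [Fin.lt_def]; simpa using hjp)]
      rfl
    · rw [Fin.succAbove_of_castSucc_lt _ _ (by rw [Fin.lt_def]; simp; omega)]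
      rfl
  set e := (insert ((j.val + 1 : ℕ) + 1 / 2 : ℚ) ((labels (N + 1)).erase (lab p))).orderIsoOfFin
    (card_replace p (j.val + 1))
  have he1 : e r = ⟨_, Finset.mem_insert_self _ _⟩ := orderIsoOfFin_replace_same p r _ hr'
  have he2 : ∀ k, e (r.succAbove k) = ⟨lab (p.succAbove k),
      Finset.mem_insert_of_mem (lab_mem_erase p k)⟩ := fun k =>
    Subtype.ext (orderIsoOfFin_replace_succAbove p r _ hr' k)
  have he3 : e j = ⟨lab j, Finset.mem_insert_of_mem (Finset.mem_erase.2
      ⟨fun e => hj (lab_injective e), lab_mem j⟩)⟩ := by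
    apply Subtype.ext
    have := he2 j₀
    rw [hj₀'] at this
    exact (congrArg Subtype.val this).trans (congrArg lab hj₀)
  have hswap : ∀ x, swap (e r) (e j) (e x) = e (swap j r x) := fun x => by
    rw [swap_comm j r]
    exact (e.injective.map_swap r j x).symm
  apply norm_eq_of_forall
  intro x
  change _ = e (τ x)
  have hins : ∀ y, insertBefore (collapse (onLabels π) (lab p)) ((j.val + 1 : ℕ) + 1 / 2)
      ⟨lab j, Finset.mem_erase.2 ⟨fun e => hj (lab_injective e), lab_mem j⟩⟩ y =
      swap (e r) (e j) (addFixedPoint (collapse (onLabels π) (lab p)) ((j.val + 1 : ℕ) + 1 / 2) y) := by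
    intro y
    rw [he1, he3]
    rfl
  rw [hins]
  rcases Fin.eq_self_or_eq_succAbove r x with hx | ⟨k, rfl⟩
  · have : addFixedPoint (collapse (onLabels π) (lab p)) ((j.val + 1 : ℕ) + 1 / 2) (e x) = e r := by
      rw [hx, he1]
      exact Subtype.ext (addFixedPoint_self _ (half_notMem_erase p _))
    rw [this, swap_apply_left, hx, hτ]
  · have : addFixedPoint (collapse (onLabels π) (lab p)) ((j.val + 1 : ℕ) + 1 / 2)
        (e (r.succAbove k)) = e (r.succAbove (κ k)) := by
      rw [he2, he2]
      apply Subtype.ext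
      rw [addFixedPoint_of_mem _ (lab_mem_erase p k), collapse_onLabels h]
    rw [this, hswap, hτ']

end PermChain

namespace PermutationTableau

variable {n N : ℕ}

/-! ### Counting rows and columns -/

/-- The number of rows whose label lies before position `m`. -/
def rowsBefore (T : PermutationTableau n) (m : ℕ) : ℕ :=
  (Finset.univ.filter fun k : Fin n => T.south k = true ∧ k.val < m).card

/-- The number of columns whose label does not lie before position `m`. -/
def colsFrom (T : PermutationTableau n) (m : ℕ) : ℕ :=
  (Finset.univ.filter fun k : Fin n => T.south k = false ∧ m ≤ k.val).card

theorem rowsBefore_mono (T : PermutationTableau n) {m m' : ℕ} (h : m ≤ m') :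
    T.rowsBefore m ≤ T.rowsBefore m' :=
  Finset.card_le_card fun k hk => by
    simp only [Finset.mem_filter] at hk ⊢
    exact ⟨hk.1, hk.2.1, hk.2.2.trans_le h⟩

theorem colsFrom_anti (T : PermutationTableau n) {m m' : ℕ} (h : m ≤ m') :
    T.colsFrom m' ≤ T.colsFrom m :=
  Finset.card_le_card fun k hk => by
    simp only [Finset.mem_filter] at hk ⊢
    exact ⟨hk.1, hk.2.1, h.trans hk.2.2⟩

theorem IsRow.rowsBefore_succ {T : PermutationTableau n} {k : Fin n} (h : T.IsRow k) :
    T.rowsBefore (k.val + 1) = T.rowsBefore k.val + 1 := by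
  rw [rowsBefore, rowsBefore, ← Finset.card_insert_of_notMem (a := k) (by simp)]
  congr 1
  ext l
  simp only [Finset.mem_filter, Finset.mem_univ, true_and, Finset.mem_insert]
  constructor
  · rintro ⟨h1, h2⟩
    by_cases hl : l = k
    · exact Or.inl hl
    · exact Or.inr ⟨h1, by have : l.val ≠ k.val := fun e => hl (Fin.ext e); omega⟩
  · rintro (rfl | ⟨h1, h2⟩)
    · exact ⟨h, by omega⟩
    · exact ⟨h1, by omega⟩

theorem IsCol.rowsBefore_succ {T : PermutationTableau n} {k : Fin n} (h : T.IsCol k) :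
    T.rowsBefore (k.val + 1) = T.rowsBefore k.val := by
  rw [rowsBefore, rowsBefore]
  congr 1
  ext l
  simp only [Finset.mem_filter, Finset.mem_univ, true_and]
  refine ⟨fun ⟨h1, h2⟩ => ⟨h1, ?_⟩, fun ⟨h1, h2⟩ => ⟨h1, by omega⟩⟩
  have : l.val ≠ k.val := fun e => IsRow.not_isCol h1 (Fin.ext e ▸ h)
  omega

theorem IsCol.colsFrom_succ {T : PermutationTableau n} {k : Fin n} (h : T.IsCol k) :
    T.colsFrom k.val = T.colsFrom (k.val + 1) + 1 := by
  rw [colsFrom, colsFrom, ← Finset.card_insert_of_notMem (a := k) (by simp)]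
  congr 1
  ext l
  simp only [Finset.mem_filter, Finset.mem_univ, true_and, Finset.mem_insert]
  constructor
  · rintro ⟨h1, h2⟩
    by_cases hl : l = k
    · exact Or.inl hl
    · exact Or.inr ⟨h1, by have : l.val ≠ k.val := fun e => hl (Fin.ext e); omega⟩
  · rintro (rfl | ⟨h1, h2⟩)
    · exact ⟨h, by omega⟩
    · exact ⟨h1, by omega⟩

theorem IsRow.colsFrom_succ {T : PermutationTableau n} {k : Fin n} (h : T.IsRow k) :
    T.colsFrom (k.val + 1) = T.colsFrom k.val := by
  rw [colsFrom, colsFrom]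
  congr 1
  ext l
  simp only [Finset.mem_filter, Finset.mem_univ, true_and]
  refine ⟨fun ⟨h1, h2⟩ => ⟨h1, by omega⟩, fun ⟨h1, h2⟩ => ⟨h1, ?_⟩⟩
  have : l.val ≠ k.val := fun e => IsRow.not_isCol h (Fin.ext e ▸ h1)
  omega

theorem rowLen_eq_colsFrom (T : PermutationTableau n) (i : Fin n) :
    T.rowLen i = T.colsFrom (i.val + 1) := rfl

theorem colLen_eq_rowsBefore (T : PermutationTableau n) (j : Fin n) :
    T.colLen j = T.rowsBefore j.val := rfl

theorem numCols_eq_colsFrom (T : PermutationTableau n) : T.numCols = T.colsFrom 0 := by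
  simp [numCols, colsFrom]

theorem numRows_eq_rowsBefore (T : PermutationTableau n) : T.numRows = T.rowsBefore n := by
  simp [numRows, rowsBefore]

theorem IsDeletion.colsFrom_succ {T : PermutationTableau (N + 1)} {D : PermutationTableau N}
    {r : Fin (N + 1)} (h : T.IsDeletion r D) {b : ℕ} (hb : r.val ≤ b) :
    T.colsFrom (b + 1) = D.colsFrom b := by
  rw [colsFrom, colsFrom, ← Finset.card_map r.succAboveEmb]
  congr 1
  ext l
  simp only [Finset.mem_filter, Finset.mem_univ, true_and, Finset.mem_map,
    Fin.coe_succAboveEmb]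
  constructor
  · rintro ⟨h1, h2⟩
    rcases Fin.eq_self_or_eq_succAbove r l with rfl | ⟨k, rfl⟩
    · omega
    · refine ⟨k, ⟨(h.1 k).symm.trans h1, ?_⟩, rfl⟩
      rw [val_succAbove] at h2
      split_ifs at h2 <;> omega
  · rintro ⟨k, ⟨h1, h2⟩, rfl⟩
    refine ⟨(h.1 k).trans h1, ?_⟩
    rw [val_succAbove]
    split_ifs <;> omega

theorem IsDeletion.rowsBefore_eq {T : PermutationTableau (N + 1)} {D : PermutationTableau N}
    {r : Fin (N + 1)} (h : T.IsDeletion r D) {b : ℕ} (hb : b ≤ r.val) :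
    T.rowsBefore b = D.rowsBefore b := by
  rw [rowsBefore, rowsBefore, ← Finset.card_map r.succAboveEmb]
  congr 1
  ext l
  simp only [Finset.mem_filter, Finset.mem_univ, true_and, Finset.mem_map,
    Fin.coe_succAboveEmb]
  constructor
  · rintro ⟨h1, h2⟩
    rcases Fin.eq_self_or_eq_succAbove r l with rfl | ⟨k, rfl⟩
    · omega
    · refine ⟨k, ⟨(h.1 k).symm.trans h1, ?_⟩, rfl⟩
      rw [val_succAbove] at h2
      split_ifs at h2 <;> omega
  · rintro ⟨k, ⟨h1, h2⟩, rfl⟩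
    refine ⟨(h.1 k).trans h1, ?_⟩
    rw [val_succAbove]
    split_ifs <;> omega

theorem IsDeletion.isRow_succAbove {T : PermutationTableau (N + 1)} {D : PermutationTableau N}
    {r : Fin (N + 1)} (h : T.IsDeletion r D) (k : Fin N) :
    T.IsRow (r.succAbove k) ↔ D.IsRow k := by
  rw [IsRow, IsRow, h.1]

theorem IsDeletion.isCol_succAbove {T : PermutationTableau (N + 1)} {D : PermutationTableau N}
    {r : Fin (N + 1)} (h : T.IsDeletion r D) (k : Fin N) :
    T.IsCol (r.succAbove k) ↔ D.IsCol k := by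
  rw [IsCol, IsCol, h.1]

theorem IsDeletion.isCol_iff_of_le {T : PermutationTableau (N + 1)} {D : PermutationTableau N}
    {r x : Fin (N + 1)} (h : T.IsDeletion r D) {k : Fin N} (hrk : r.val ≤ k.val)
    (hx : x.val = k.val + 1) : T.IsCol x ↔ D.IsCol k := by
  rw [← h.isCol_succAbove, show x = r.succAbove k from Fin.ext (by
    rw [val_succAbove, if_neg (by omega), hx])]

theorem IsDeletion.isRow_iff_of_le {T : PermutationTableau (N + 1)} {D : PermutationTableau N}
    {r x : Fin (N + 1)} (h : T.IsDeletion r D) {k : Fin N} (hrk : r.val ≤ k.val)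
    (hx : x.val = k.val + 1) : T.IsRow x ↔ D.IsRow k := by
  rw [← not_iff_not, not_isRow, not_isRow]
  exact h.isCol_iff_of_le hrk hx

theorem IsDeletion.isRow_iff_of_lt {T : PermutationTableau (N + 1)} {D : PermutationTableau N}
    {r x : Fin (N + 1)} (h : T.IsDeletion r D) {k : Fin N} (hrk : k.val < r.val)
    (hx : x.val = k.val) : T.IsRow x ↔ D.IsRow k := by
  rw [← h.isRow_succAbove, show x = r.succAbove k from Fin.ext (by
    rw [val_succAbove, if_pos (by omega), hx])]

/-! ### The position of a new line -/

/-- `m` is the label of a column of `D`, or the end of the border of `D`. -/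
def IsColOrEnd (D : PermutationTableau N) (m : ℕ) : Prop :=
  m = N ∨ ∃ k : Fin N, k.val = m ∧ D.IsCol k

/-- The count `colsFrom` drops exactly on passing a column, so it keeps its value from `b` to the
first column at or after `b`, or to the end, and no further. -/
theorem IsColOrEnd.colsFrom_eq_iff {D : PermutationTableau N} {b m : ℕ} (hb : b ≤ N)
    (hm : D.IsColOrEnd m) :
    D.colsFrom m = D.colsFrom b ↔ IsLeast {c | b ≤ c ∧ D.IsColOrEnd c} m := by
  have hmN : m ≤ N := by
    rcases hm with rfl | ⟨k, rfl, -⟩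
    · exact le_rfl
    · exact k.isLt.le
  constructor
  · intro h
    refine ⟨⟨?_, hm⟩, ?_⟩
    · by_contra hlt
      rcases hm with rfl | ⟨k, rfl, hk⟩
      · omega
      · rw [hk.colsFrom_succ] at h
        have := D.colsFrom_anti (show k.val + 1 ≤ b by omega)
        omega
    · rintro c ⟨hbc, hc⟩
      by_contra hlt
      rcases hc with rfl | ⟨k, rfl, hk⟩
      · omega
      · have h1 := D.colsFrom_anti hbc
        rw [hk.colsFrom_succ] at h1
        have := D.colsFrom_anti (show k.val + 1 ≤ m by omega)
        omega
  · rintro ⟨⟨h1, -⟩, h2⟩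
    rw [colsFrom, colsFrom]
    congr 1
    ext k
    simp only [Finset.mem_filter, Finset.mem_univ, true_and]
    exact ⟨fun h => ⟨h.1, h1.trans h.2⟩, fun h => ⟨h.1, h2 ⟨h.2, Or.inr ⟨k, rfl, h.1⟩⟩⟩⟩

theorem IsRow.rowsBefore_eq_iff {D : PermutationTableau N} {j : Fin N} (hj : D.IsRow j) {x : ℕ} :
    D.rowsBefore (j.val + 1) = D.rowsBefore x ↔ IsGreatest {k : Fin N | k.val < x ∧ D.IsRow k} j := by
  constructor
  · intro h
    refine ⟨⟨?_, hj⟩, ?_⟩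
    · by_contra hlt
      rw [hj.rowsBefore_succ] at h
      have := D.rowsBefore_mono (show x ≤ j.val by omega)
      omega
    · rintro k ⟨hkx, hk⟩
      by_contra hlt
      have h1 := D.rowsBefore_mono (show k.val + 1 ≤ x by omega)
      rw [hk.rowsBefore_succ] at h1
      have := D.rowsBefore_mono (show j.val + 1 ≤ k.val by rw [Fin.le_def] at hlt; omega)
      omega
  · rintro ⟨⟨h1, -⟩, h2⟩
    rw [rowsBefore, rowsBefore]
    congr 1
    ext k
    simp only [Finset.mem_filter, Finset.mem_univ, true_and]
    refine ⟨fun h => ⟨h.1, by omega⟩, fun h => ⟨h.1, ?_⟩⟩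
    have := Fin.le_def.1 (h2 ⟨h.2, h.1⟩)
    omega

/-- The row is as far south as possible exactly when the next border step is not a row. That step of
`T` is step `r` of `D`. -/
theorem IsDeletion.isNewRow_iff {T : PermutationTableau (N + 1)} {D : PermutationTableau N}
    {r : Fin (N + 1)} (h : T.IsDeletion r D) {ℓ : ℕ} :
    T.IsNewRow r ℓ ↔ T.IsRow r ∧ (∀ j, T.one r j = false) ∧ D.colsFrom r = ℓ ∧
      D.IsColOrEnd r := by
  rw [IsNewRow, rowLen_eq_colsFrom, h.colsFrom_succ le_rfl]
  constructor
  · rintro ⟨hr, hℓ, hz, hlt⟩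
    refine ⟨hr, hz, hℓ, ?_⟩
    by_cases hrN : r.val = N
    · exact Or.inl hrN
    · refine Or.inr ⟨⟨r.val, by omega⟩, rfl, ?_⟩
      have hx := h.isRow_iff_of_le (k := ⟨r.val, by omega⟩) le_rfl
        (x := ⟨r.val + 1, by omega⟩) rfl
      refine (D.isRow_or_isCol _).resolve_left fun hrow => ?_
      have := hlt ⟨r.val + 1, by omega⟩ (by rw [Fin.lt_def]; simp) (hx.2 hrow)
      rw [rowLen_eq_colsFrom] at this
      have h2 := (hx.2 hrow).colsFrom_succ
      rw [h.colsFrom_succ le_rfl] at h2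
      exact this.ne h2
  · rintro ⟨hr, hz, hℓ, hcol⟩
    refine ⟨hr, hℓ, hz, fun i hi hrow => ?_⟩
    rw [rowLen_eq_colsFrom]
    rw [Fin.lt_def] at hi
    rcases hcol with hrN | ⟨k, hk, hk'⟩
    · omega
    · have hx := (h.isCol_iff_of_le (k := k) hk.ge (x := ⟨r.val + 1, by omega⟩) (by simp [hk])).2 hk'
      have h2 : T.colsFrom (r.val + 1) = T.colsFrom (r.val + 1 + 1) + 1 := hx.colsFrom_succ
      rw [h.colsFrom_succ le_rfl] at h2
      have hne : i.val ≠ r.val + 1 := fun e => by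
        rw [show i = ⟨r.val + 1, by omega⟩ from Fin.ext e] at hrow
        exact hrow.not_isCol hx
      have := T.colsFrom_anti (show r.val + 1 + 1 ≤ i.val + 1 by omega)
      omega

/-- The column is as far east as possible exactly when the preceding border step is a row; this row
then holds the bottom entry, so the column forms a necessary corner with it. -/
theorem IsDeletion.isNewCol_iff {T : PermutationTableau (N + 1)} {D : PermutationTableau N}
    {r : Fin (N + 1)} (h : T.IsDeletion r D) {ℓ : ℕ} :
    T.IsNewCol r ℓ ↔ ∃ j : Fin N, r = j.succ ∧ D.IsRow j ∧ T.IsNecessaryCorner j.castSucc r ∧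
      D.rowsBefore (j.val + 1) = ℓ := by
  rw [IsNewCol, colLen_eq_rowsBefore, h.rowsBefore_eq le_rfl]
  constructor
  · rintro ⟨hr, hℓ, hone, hlt⟩
    have hr0 : r.val ≠ 0 := fun h0 => IsRow.not_isCol (T.south_first r h0) hr
    obtain ⟨j, rfl⟩ := Fin.exists_succ_eq.2 (show r ≠ 0 from fun e => hr0 (by simp [e]))
    have hjr : T.IsRow j.castSucc := by
      refine (T.isRow_or_isCol _).resolve_right fun hcol => ?_
      have h1 := hlt _ (by rw [Fin.lt_def]; simp) hcol
      rw [colLen_eq_rowsBefore] at h1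
      have h2 := hcol.rowsBefore_succ
      rw [Fin.val_castSucc, ← Fin.val_succ, h.rowsBefore_eq le_rfl] at h2
      exact h1.ne h2.symm
    refine ⟨j, rfl, ?_, ⟨by simp, hjr, hr, fun k => ?_⟩, by simpa using hℓ⟩
    · exact (h.isRow_iff_of_lt (by simp) (by simp)).1 hjr
    · rw [hone]
      constructor
      · rintro ⟨h1, h2, h3⟩
        by_contra hne
        refine h3 j.castSucc ?_ (by rw [Fin.lt_def]; simp) hjr
        rw [Fin.lt_def] at *
        have : k.val ≠ j.val := fun e => hne (Fin.ext e)
        simp at *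
        omega
      · rintro rfl
        refine ⟨hjr, by rw [Fin.lt_def]; simp, fun i h1 h2 => ?_⟩
        rw [Fin.lt_def] at *
        simp at *
        omega
  · rintro ⟨j, rfl, hj, hc, hℓ⟩
    refine ⟨hc.2.2.1, by simpa using hℓ, fun i => ?_, fun k hk hcol => ?_⟩
    · rw [hc.2.2.2]
      constructor
      · rintro rfl
        refine ⟨hc.2.1, by rw [Fin.lt_def]; simp, fun i h1 h2 => ?_⟩
        rw [Fin.lt_def] at *
        simp at *
        omega
      · rintro ⟨h1, h2, h3⟩
        by_contra hne
        refine h3 j.castSucc ?_ (by rw [Fin.lt_def]; simp) hc.2.1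
        rw [Fin.lt_def] at *
        have : i.val ≠ j.val := fun e => hne (Fin.ext e)
        simp at *
        omega
    · rw [colLen_eq_rowsBefore]
      have hne : k.val ≠ j.val := fun e => by
        rw [show k = j.castSucc from Fin.ext e] at hcol
        exact hc.2.1.not_isCol hcol
      rw [Fin.lt_def, Fin.val_succ] at hk
      have h1 := T.rowsBefore_mono (show k.val ≤ j.castSucc.val by simp; omega)
      have h2 := hc.2.1.rowsBefore_succ
      rw [Fin.val_castSucc, ← Fin.val_succ, h.rowsBefore_eq le_rfl] at h2
      rw [Fin.val_castSucc] at h1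
      omega

/-- The offset `2` is made of one for labels starting at `1` and one for the deleted `p ≤ b`: step
`c ≥ b` of `D` is step `c + 1` of `S`, with label `c + 2`. The end `N` of the border becomes the
default `N + 2`. -/
theorem IsDeletion.isNextNonexc_iff {S : PermutationTableau (N + 1)} {D : PermutationTableau N}
    {p : Fin (N + 1)} (h : S.IsDeletion p D) {b m : ℕ} (hp : p.val ≤ b) (hb : b ≤ N) :
    PermChain.IsNextNonexc S.phi (b + 1) (m + 2) ↔ IsLeast {c | b ≤ c ∧ D.IsColOrEnd c} m := by
  have key : ∀ c, c + 2 ∈ (insert (N + 1 + 1) {k | b + 1 < k ∧ ∃ x : Fin (N + 1), x.val + 1 = k ∧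
      PermChain.IsNonexc S.phi x}) ↔ c ∈ {c | b ≤ c ∧ D.IsColOrEnd c} := by
    intro c
    simp only [Set.mem_insert_iff, Set.mem_ofPred_eq, IsColOrEnd]
    constructor
    · rintro (hc | ⟨h1, x, h2, h3⟩)
      · exact ⟨by omega, Or.inl (by omega)⟩
      · refine ⟨by omega, Or.inr ⟨⟨c, by omega⟩, rfl, ?_⟩⟩
        exact (h.isCol_iff_of_le (x := x) (by simp; omega) (by simp; omega)).1
          ((S.isCol_iff_phi_lt x).2 h3)
    · rintro ⟨h1, hc | ⟨k, rfl, hk⟩⟩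
      · exact Or.inl (by omega)
      · refine Or.inr ⟨by omega, ⟨k.val + 1, by omega⟩, rfl, ?_⟩
        exact (S.isCol_iff_phi_lt _).1 ((h.isCol_iff_of_le (by omega) rfl).2 hk)
  rw [PermChain.IsNextNonexc]
  constructor
  · rintro ⟨h1, h2⟩
    refine ⟨(key m).1 h1, fun c hc => ?_⟩
    have := h2 ((key c).2 hc)
    omega
  · rintro ⟨h1, h2⟩
    refine ⟨(key m).2 h1, fun c hc => ?_⟩
    have hc2 : 2 ≤ c := by
      rcases hc with hc | ⟨hc, -⟩ <;> omega
    obtain ⟨c, rfl⟩ := Nat.exists_eq_add_of_le' hc2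
    have := h2 ((key c).1 hc)
    omega

theorem IsDeletion.isPrevWeakExc_iff {S : PermutationTableau (N + 1)} {D : PermutationTableau N}
    {p x : Fin (N + 1)} (h : S.IsDeletion p D) (hx : x ≤ p) {j : Fin N} :
    PermChain.IsPrevWeakExc S.phi x j.castSucc ↔
      IsGreatest {k : Fin N | k.val < x.val ∧ D.IsRow k} j := by
  rw [Fin.le_def] at hx
  have key : ∀ k : Fin N, k.castSucc ∈ {j | j < x ∧ PermChain.IsWeakExc S.phi j} ↔
      k ∈ {k : Fin N | k.val < x.val ∧ D.IsRow k} := by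
    intro k
    simp only [Set.mem_ofPred_eq, PermChain.IsWeakExc, ← isRow_iff_le_phi, Fin.lt_def,
      Fin.val_castSucc]
    refine and_congr_right fun hk => ?_
    exact h.isRow_iff_of_lt (by omega) (by simp)
  rw [PermChain.IsPrevWeakExc]
  constructor
  · rintro ⟨h1, h2⟩
    exact ⟨(key j).1 h1, fun c hc => Fin.castSucc_le_castSucc_iff.1 (h2 ((key c).2 hc))⟩
  · rintro ⟨h1, h2⟩
    refine ⟨(key j).2 h1, fun c hc => ?_⟩
    obtain ⟨c, rfl⟩ : ∃ k : Fin N, c = k.castSucc :=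
      ⟨⟨c.val, by have := Fin.lt_def.1 hc.1; have := p.isLt; omega⟩, rfl⟩
    exact Fin.castSucc_le_castSucc_iff.2 (h2 ((key c).1 hc))

variable {S T : PermutationTableau (N + 1)}

/-! ### The moves on tableaux and on permutations -/

theorem ReplaceLine.isDeletion {p r : Fin (N + 1)} (h : S.ReplaceLine T p r)
    {D : PermutationTableau N} (hD : S.IsDeletion p D) : T.IsDeletion r D :=
  ⟨fun k => (h.1 k).trans (hD.1 k), fun k l => (h.2 k l).trans (hD.2 k l)⟩

theorem IsDeletion.replaceLine {p r : Fin (N + 1)} {D : PermutationTableau N}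
    (hD : S.IsDeletion p D) (h : T.IsDeletion r D) : S.ReplaceLine T p r :=
  ⟨fun k => (h.1 k).trans (hD.1 k).symm, fun k l => (h.2 k l).trans (hD.2 k l).symm⟩

/-- Replacing a line by an all-zero row corresponds to collapsing the permutation and adding a
fixed point. -/
theorem IsDeletion.newRow_iff {D : PermutationTableau N} {p : Fin (N + 1)}
    (hD : S.IsDeletion p D) (hκ : IsCollapse S.phi p D.phi) {b : ℕ} (hp : p.val ≤ b)
    (hb : b ≤ N) :
    (∃ r, S.ReplaceLine T p r ∧ T.IsNewRow r (D.colsFrom b)) ↔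
      ∃ m : ℕ, PermChain.IsNextNonexc S.phi (b + 1) (m + 1) ∧
        T.phi = PermChain.collapseAddFixed S.phi p m := by
  constructor
  · rintro ⟨r, hR, hnew⟩
    have hT := hR.isDeletion hD
    obtain ⟨hr, hz, hc, he⟩ := hT.isNewRow_iff.1 hnew
    have hleast := (he.colsFrom_eq_iff hb).1 hc
    -- Here `m = r + 1`: the deleted label `p + 1` is at most `m`, so `m + 1/2` lands at position `m
    -- - 1 = r`.
    refine ⟨r.val + 1, (hD.isNextNonexc_iff hp hb).2 hleast, ?_⟩
    have hbr : b ≤ r.val := hleast.1.1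
    exact (PermChain.collapseAddFixed_eq hκ (by rw [if_pos (by omega)]; rfl)
      (phi_eq_of_zeroRow hr hz) (hT.phi_zeroRow hr hz)).symm
  · rintro ⟨m, hnext, hphi⟩
    have hm : 1 ≤ m := by
      rcases hnext.1 with h | ⟨h, -⟩ <;> omega
    obtain ⟨m, rfl⟩ := Nat.exists_eq_add_of_le' hm
    have hleast := (hD.isNextNonexc_iff hp hb).1 hnext
    have hbm : b ≤ m := hleast.1.1
    have hmN : m < N + 1 := by
      rcases hleast.1.2 with h | ⟨k, h, -⟩ <;> omega
    have hdel := D.isDeletion_insertRow ⟨m, hmN⟩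
    have hrow := D.isRow_insertRow ⟨m, hmN⟩
    have hz := D.insertRow_zero ⟨m, hmN⟩
    -- Only the permutation of `T` is known; injectivity of `phi` identifies `T` with the explicit
    -- tableau.
    have hT : T = D.insertRow ⟨m, hmN⟩ := by
      apply phi_injective
      rw [hphi]
      exact PermChain.collapseAddFixed_eq hκ (by rw [if_pos (by omega)]; rfl)
        (phi_eq_of_zeroRow hrow hz) (hdel.phi_zeroRow hrow hz)
    refine ⟨⟨m, hmN⟩, hD.replaceLine (hT ▸ hdel), ?_⟩
    rw [hT, hdel.isNewRow_iff]
    exact ⟨hrow, hz, (hleast.1.2.colsFrom_eq_iff hb).2 hleast, hleast.1.2⟩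

/-- Replacing a line by a column with a `1` at the bottom and `0`s elsewhere corresponds to
collapsing the permutation and inserting a label before a weak excedance. -/
theorem IsDeletion.newCol_iff {D : PermutationTableau N} {p x : Fin (N + 1)}
    (hD : S.IsDeletion p D) (hκ : IsCollapse S.phi p D.phi) (hx : x ≤ p) :
    (∃ r, S.ReplaceLine T p r ∧ T.IsNewCol r (D.rowsBefore x)) ↔
      ∃ (j : Fin (N + 1)) (h : j ≠ p), PermChain.IsPrevWeakExc S.phi x j ∧
        T.phi = PermChain.collapseInsertBefore S.phi p j h := by
  constructor
  · rintro ⟨r, hR, hnew⟩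
    have hT := hR.isDeletion hD
    obtain ⟨j, rfl, hj, hc, hl⟩ := hT.isNewCol_iff.1 hnew
    have hgr := hj.rowsBefore_eq_iff.1 hl
    have hjx : j.castSucc < p := by
      rw [Fin.lt_def]
      exact lt_of_lt_of_le hgr.1.1 hx
    refine ⟨j.castSucc, hjx.ne, (hD.isPrevWeakExc_iff hx).2 hgr, ?_⟩
    exact (PermChain.collapseInsertBefore_eq hjx.ne hκ hjx (by simp) hc.phi_eq
      (hT.phi_necessaryCorner hc)).symm
  · rintro ⟨j, hjp, hprev, hphi⟩
    have hjx : j < p := lt_of_lt_of_le hprev.1.1 hx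
    obtain ⟨j, rfl⟩ : ∃ k : Fin N, j = k.castSucc :=
      ⟨⟨j.val, by have := Fin.lt_def.1 hjx; have := p.isLt; omega⟩, rfl⟩
    have hgr := (hD.isPrevWeakExc_iff hx).1 hprev
    have hj : D.IsRow j := hgr.1.2
    have hdel := D.isDeletion_insertCol j hj
    have hc := D.isNecessaryCorner_insertCol j hj
    have hT : T = D.insertCol j hj := by
      apply phi_injective
      rw [hphi]
      exact PermChain.collapseInsertBefore_eq hjx.ne hκ hjx (by simp) hc.phi_eq
        (hdel.phi_necessaryCorner hc)
    refine ⟨j.succ, hD.replaceLine (hT ▸ hdel), ?_⟩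
    rw [hT, hdel.isNewCol_iff]
    exact ⟨j, rfl, hj, hc, hj.rowsBefore_eq_iff.2 hgr⟩

theorem zeroRow_of_corner_zero {S : PermutationTableau n} {i i' : Fin n} (h : i'.val = i.val + 1)
    (hi : S.IsRow i) (hi' : S.IsCol i') (hz : S.one i i' = false) :
    1 ≤ i.val ∧ ∀ j, S.one i j = false := by
  rcases S.corner_cases h hi hi' with ⟨h1, -, h2⟩ | hc | ⟨hone, -⟩
  · exact ⟨h1, h2⟩
  · rw [(hc.2.2.2 i).2 rfl] at hz; exact absurd hz (by simp)
  · rw [hone] at hz; exact absurd hz (by simp)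

/-- Column `i'` of `S` is step `i` of `D`, so losing one box means counting the columns from step
`i'` of `D` on. -/
theorem IsDeletion.rowLen_sub_one {D : PermutationTableau N} {i i' : Fin (N + 1)}
    (hD : S.IsDeletion i D) (h : i'.val = i.val + 1) (hi' : S.IsCol i') :
    S.rowLen i - 1 = D.colsFrom i'.val := by
  have hcol := (hD.isCol_iff_of_le (k := ⟨i.val, by omega⟩) le_rfl h).1 hi'
  rw [rowLen_eq_colsFrom, hD.colsFrom_succ le_rfl, hcol.colsFrom_succ, h, Nat.add_sub_cancel]

theorem IsDeletion.colLen_sub_one {D : PermutationTableau N} {i i' : Fin (N + 1)}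
    (hD : S.IsDeletion i' D) (h : i'.val = i.val + 1) (hi : S.IsRow i) :
    S.colLen i' - 1 = D.rowsBefore i.val := by
  rw [colLen_eq_rowsBefore, h, hi.rowsBefore_succ, Nat.add_sub_cancel, hD.rowsBefore_eq (by omega)]

theorem exists_isDeletion_zeroRow {p : Fin (N + 1)} (hp : 1 ≤ p.val) (hz : ∀ j, S.one p j = false) :
    ∃ D, S.IsDeletion p D :=
  ⟨_, S.isDeletion_deleteLine p hp fun _ => hz⟩

theorem exists_isDeletion_col {p : Fin (N + 1)} (hp : S.IsCol p) : ∃ D, S.IsDeletion p D := by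
  have hp1 : 1 ≤ p.val := by
    by_contra h0
    exact IsRow.not_isCol (S.south_first p (by omega)) hp
  exact ⟨_, S.isDeletion_deleteLine p hp1 fun hr => absurd hp hr.not_isCol⟩

/-- A rightmost column of length `1` has the label `2`, and its single box must be a `1`, so it is a
necessary corner at the top row. In the permutation this reads `π 2 = 1`, and deleting the column is
the collapse at `2`. -/
theorem entersLeft_iff (hN : 1 ≤ N) :
    S.EntersLeft T ↔ PermChain.EntersLeft S.phi T.phi := by
  have h0 : S.IsRow 0 := S.south_first 0 rfl
  have hcorner : ∀ p : Fin (N + 1), p.val = 1 → S.IsCol p → S.IsNecessaryCorner 0 p := by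
    intro p hp1 hp
    obtain ⟨k, hk⟩ := S.exists_one p hp
    have h : ∀ k, S.one k p = true → k = 0 := fun k hk => by
      have := lt_of_one hk
      rw [Fin.lt_def, hp1] at this
      exact Fin.ext (by simpa using this)
    exact ⟨by simp [hp1], h0, hp, fun l => ⟨h l, fun hl => by rw [hl, ← h k hk]; exact hk⟩⟩
  have hcount : ∀ p : Fin (N + 1), p.val = 1 → S.IsCol p → ∀ D, S.IsDeletion p D →
      S.numCols - 1 = D.colsFrom 1 := by
    intro p hp1 hp D hD
    have h1 := h0.colsFrom_succ
    have h2 := hp.colsFrom_succ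
    rw [hp1] at h2
    rw [Fin.val_zero, zero_add] at h1
    rw [numCols_eq_colsFrom, ← h1, h2, hD.colsFrom_succ hp1.le, Nat.add_sub_cancel]
  constructor
  · rintro ⟨p, r, hp, hmin, hlen, hR, hnew⟩
    have hp1 : p.val = 1 := by
      -- All steps before the rightmost column are rows, so its length is its zero-based label.
      have : (Finset.univ.filter fun i => S.south i = true ∧ i < p) = Finset.Iio p := by
        ext i
        simp only [Finset.mem_filter, Finset.mem_univ, true_and, Finset.mem_Iio,
          and_iff_right_iff_imp]
        exact fun hi => (S.isRow_or_isCol i).resolve_right fun hc => (hmin i hc).not_gt hi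
      rw [colLen, this, Fin.card_Iio] at hlen
      exact hlen
    have hc := hcorner p hp1 hp
    obtain ⟨D, hD⟩ := exists_isDeletion_col hp
    rw [hcount p hp1 hp _ hD] at hnew
    refine ⟨p, by omega, by simp [hc.phi_eq], ?_⟩
    exact (hD.newRow_iff (hD.isCollapse_necessaryCorner hc) hp1.le hN).1
      ⟨r, hR, hnew⟩
  · rintro ⟨p, hp2, hpi, hnext⟩
    have hp1 : p.val = 1 := by omega
    have hp : S.IsCol p := (S.isCol_iff_phi_lt p).2 (by rw [Fin.lt_def]; omega)
    have hc := hcorner p hp1 hp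
    obtain ⟨D, hD⟩ := exists_isDeletion_col hp
    have hmin : ∀ j, S.IsCol j → p ≤ j := fun j hj => by
      have : j.val ≠ 0 := fun e => IsRow.not_isCol (S.south_first j e) hj
      rw [Fin.le_def]
      omega
    obtain ⟨r, hR, hnew⟩ := (hD.newRow_iff (T := T) (hD.isCollapse_necessaryCorner hc) hp1.le
      hN).2 hnext
    refine ⟨p, r, hp, hmin, ?_, hR, (hcount p hp1 hp _ hD) ▸ hnew⟩
    have h1 := h0.rowsBefore_succ
    rw [colLen_eq_rowsBefore, hp1]
    simpa [rowsBefore] using h1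

/-- The three alternatives match one by one, since zero, superfluous and necessary corner entries
are distinguished by the images of `i` and `i'`. -/
theorem hopsRight_iff : S.HopsRight T ↔ PermChain.HopsRight S.phi T.phi := by
  unfold HopsRight PermChain.HopsRight
  refine exists_congr fun i => exists_congr fun i' => ?_
  refine and_congr (by omega) (and_congr_right fun h => ?_)
  rw [← isRow_iff_le_phi, ← isCol_iff_phi_lt]
  refine and_congr_right fun hi => and_congr_right fun hi' => ?_
  have hlt : i < i' := by rw [Fin.lt_def]; omega
  refine or_congr ?_ (or_congr ?_ ?_)
  · have hiff : S.one i i' = false ↔ S.phi i = i :=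
      ⟨fun hz => phi_eq_of_zeroRow hi (zeroRow_of_corner_zero h hi hi' hz).2,
        fun hz => zeroRow_of_phi_eq hz i'⟩
    rw [← hiff]
    refine and_congr_right fun hz => ?_
    obtain ⟨hi1, hzero⟩ := zeroRow_of_corner_zero h hi hi' hz
    obtain ⟨D, hD⟩ := exists_isDeletion_zeroRow hi1 hzero
    rw [hD.rowLen_sub_one h hi', hD.newRow_iff (hD.isCollapse_zeroRow hi hzero) (by omega)
      (by omega)]
  · constructor
    · rintro ⟨hone, h1, hA⟩
      obtain ⟨h2, h3⟩ := corner_superfluous h hi hi' hone h1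
      refine ⟨h2, h3, ?_⟩
      rw [hA.phi_eq, mul_assoc, swap_mul_self, mul_one]
    · rintro ⟨h2, h3, hphi⟩
      rcases S.corner_cases h hi hi' with ⟨-, -, hz⟩ | hc | ⟨hone, h1⟩
      · exact absurd (phi_eq_of_zeroRow hi hz) h2.ne'
      · exact absurd hc.phi_eq h3.ne
      · have hA := S.addCorner_removeCorner i i' h hi hi' h1 hone
        refine ⟨hone, h1, ?_⟩
        have : T = S.removeCorner i i' h hi hi' h1 := by
          apply phi_injective
          rw [hphi, hA.phi_eq, mul_assoc, swap_mul_self, mul_one]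
        rwa [this]
  · have hiff : (S.one i i' = true ∧ ∀ k, S.one k i' = true → k = i) ↔ S.IsNecessaryCorner i i' :=
      ⟨fun h1 => ⟨h, hi, hi', fun k => ⟨h1.2 k, fun hk => hk ▸ h1.1⟩⟩,
        fun hc => ⟨(hc.2.2.2 i).2 rfl, fun k => (hc.2.2.2 k).1⟩⟩
    have hiff' : (i < S.phi i ∧ S.phi i' = i) ↔ S.IsNecessaryCorner i i' := by
      refine ⟨fun h1 => isNecessaryCorner_of_phi_eq h hi h1.2, fun hc => ⟨?_, hc.phi_eq⟩⟩
      refine lt_of_le_of_ne ((S.isRow_iff_le_phi i).1 hi) fun e => hlt.ne ?_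
      exact S.phi.injective (e.symm.trans hc.phi_eq.symm)
    rw [← and_assoc, ← and_assoc, hiff, hiff']
    refine and_congr_right fun hc => ?_
    obtain ⟨D, hD⟩ := exists_isDeletion_col hi'
    rw [hD.colLen_sub_one h hi, hD.newCol_iff (hD.isCollapse_necessaryCorner hc) hlt.le]

/-- A last row of length `0` is the last border step, and it is a zero row for want of boxes; so the
condition is that the last label is fixed. -/
theorem exitsRight_iff (hN : 1 ≤ N) :
    S.ExitsRight T ↔ PermChain.ExitsRight S.phi T.phi := by
  have key : ∀ hp : S.IsRow (Fin.last N), (∃ r, S.ReplaceLine T (Fin.last N) r ∧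
      T.IsNewCol r (S.numRows - 1)) ↔ ∃ (i : Fin (N + 1)) (h : i ≠ Fin.last N),
      PermChain.IsPrevWeakExc S.phi (Fin.last N) i ∧
      T.phi = PermChain.collapseInsertBefore S.phi (Fin.last N) i h := by
    intro hp
    have hz : ∀ j, S.one (Fin.last N) j = false := fun j => by
      by_contra hc
      exact (Fin.le_last j).not_gt (lt_of_one (by simpa using hc))
    obtain ⟨D, hD⟩ := exists_isDeletion_zeroRow (p := Fin.last N) (by simpa using hN) hz
    have hcount : S.numRows - 1 = D.rowsBefore (Fin.last N).val := by
      have h1 := hp.rowsBefore_succ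
      rw [numRows_eq_rowsBefore, ← hD.rowsBefore_eq le_rfl]
      rw [Fin.val_last] at h1 ⊢
      rw [h1, Nat.add_sub_cancel]
    rw [hcount, hD.newCol_iff (hD.isCollapse_zeroRow hp hz) le_rfl]
  constructor
  · rintro ⟨p, r, hp, hmax, hlen, h⟩
    have hpl : p = Fin.last N := by
      by_contra hne
      have hlt := Fin.lt_last_iff_ne_last.2 hne
      rcases S.isRow_or_isCol (Fin.last N) with hl | hl
      · exact (hmax _ hl).not_gt hlt
      · rw [rowLen, Finset.card_eq_zero, Finset.filter_eq_empty_iff] at hlen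
        exact hlen (Finset.mem_univ (Fin.last N)) ⟨hl, hlt⟩
    subst hpl
    refine ⟨?_, (key hp).1 ⟨r, h⟩⟩
    exact le_antisymm (Fin.le_last _) ((S.isRow_iff_le_phi _).1 hp)
  · rintro ⟨hfix, h⟩
    have hp := (S.isRow_iff_le_phi _).2 hfix.ge
    obtain ⟨r, hr⟩ := (key hp).2 h
    refine ⟨Fin.last N, r, hp, fun i _ => Fin.le_last i, ?_, hr⟩
    rw [rowLen, Finset.card_eq_zero, Finset.filter_eq_empty_iff]
    exact fun j _ hj => (Fin.le_last j).not_gt hj.2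

theorem hopsLeft_iff : S.HopsLeft T ↔ PermChain.HopsLeft S.phi T.phi := by
  constructor
  · rintro ⟨i, i', hA⟩
    exact ⟨i, i', hA.1, (S.isCol_iff_phi_lt i).1 hA.2.1, (S.isRow_iff_le_phi i').1 hA.2.2.1,
      hA.phi_eq⟩
  · rintro ⟨i, i', h, hi, hi', hphi⟩
    have hA := S.addCorner_addCorner i i' h ((S.isCol_iff_phi_lt i).2 hi)
      ((S.isRow_iff_le_phi i').2 hi')
    refine ⟨i, i', ?_⟩
    rwa [phi_injective (hphi.trans hA.phi_eq.symm)]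

/-! ### The kinds of moves exclude each other -/

theorem ReplaceLine.numRows_add {p r : Fin (N + 1)} (h : S.ReplaceLine T p r) :
    T.numRows + (if S.south p = true then 1 else 0) =
      S.numRows + if T.south r = true then 1 else 0 := by
  simp only [numRows, Finset.card_filter]
  rw [Fin.sum_univ_succAbove _ r, Fin.sum_univ_succAbove (fun i => if S.south i = true then 1 else 0) p]
  simp only [h.1]
  omega

theorem AddCorner.numRows_eq {S T : PermutationTableau n} {i i' : Fin n} (h : S.AddCorner T i i') :
    T.numRows = S.numRows := by
  simp only [numRows, Finset.card_filter]
  rw [← Equiv.sum_comp (swap i i')]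
  simp only [h.2.2.2.1, swap_apply_self]

/-- The sum of the (zero-based) labels of the rows. -/
def rowSum (T : PermutationTableau n) : ℕ := ∑ k, if T.south k = true then k.val else 0

theorem rowSum_add_colSum (T : PermutationTableau n) :
    T.rowSum + T.colSum = ∑ k : Fin n, k.val := by
  rw [rowSum, colSum, ← Finset.sum_add_distrib]
  refine Finset.sum_congr rfl fun k _ => ?_
  split_ifs <;> simp

/-- When a row moves to a later place on the border, each column that it passes gets a smaller
label, and column `k` is one of these. -/
theorem colSum_lt_of_zeroRow {D : PermutationTableau N} {p r : Fin (N + 1)}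
    (hS : S.IsDeletion p D) (hT : T.IsDeletion r D) (hp : S.IsRow p) (hr : T.IsRow r) {k : Fin N}
    (hk : D.IsCol k) (h1 : p.val ≤ k.val) (h2 : k.val < r.val) : T.colSum < S.colSum := by
  have hp' : S.south p = true := hp
  have hr' : T.south r = true := hr
  simp only [colSum]
  rw [Fin.sum_univ_succAbove _ r, Fin.sum_univ_succAbove _ p, if_pos hp', if_pos hr', zero_add,
    zero_add]
  simp only [hS.1, hT.1]
  apply Finset.sum_lt_sum
  · intro l _
    split_ifs
    · exact le_rfl
    · rw [val_succAbove, val_succAbove]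
      split_ifs <;> omega
  · refine ⟨k, Finset.mem_univ _, ?_⟩
    have : ¬ D.south k = true := fun h => IsRow.not_isCol h hk
    rw [if_neg this, if_neg this, val_succAbove, val_succAbove, if_pos h2, if_neg (by omega)]
    omega

theorem rowSum_lt_of_col {D : PermutationTableau N} {p r : Fin (N + 1)}
    (hS : S.IsDeletion p D) (hT : T.IsDeletion r D) (hp : S.IsCol p) (hr : T.IsCol r) {k : Fin N}
    (hk : D.IsRow k) (h1 : r.val ≤ k.val) (h2 : k.val < p.val) : S.rowSum < T.rowSum := by
  have hp' : ¬ S.south p = true := fun h => IsRow.not_isCol h hp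
  have hr' : ¬ T.south r = true := fun h => IsRow.not_isCol h hr
  simp only [rowSum]
  rw [Fin.sum_univ_succAbove _ p, Fin.sum_univ_succAbove _ r, if_neg hp', if_neg hr', zero_add,
    zero_add]
  simp only [hS.1, hT.1]
  apply Finset.sum_lt_sum
  · intro l _
    split_ifs
    · rw [val_succAbove, val_succAbove]
      split_ifs <;> omega
    · exact le_rfl
  · refine ⟨k, Finset.mem_univ _, ?_⟩
    have : D.south k = true := hk
    rw [if_pos this, if_pos this, val_succAbove, val_succAbove, if_pos h2, if_neg (by omega)]
    omega

theorem EntersLeft.numRows_eq (h : S.EntersLeft T) : T.numRows = S.numRows + 1 := by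
  obtain ⟨p, r, hp, -, -, hR, hr, -⟩ := h
  have := hR.numRows_add
  rw [show T.south r = true from hr, show S.south p = false from hp] at this
  simpa using this

theorem ExitsRight.numRows_eq (h : S.ExitsRight T) : S.numRows = T.numRows + 1 := by
  obtain ⟨p, r, hp, -, -, hR, hr, -⟩ := h
  have := hR.numRows_add
  rw [show T.south r = false from hr, show S.south p = true from hp] at this
  simpa using this.symm

/-- With the analogous facts for the other moves, this shows that the kinds are disjoint: entering
and exiting change the number of rows by `1` in opposite directions, while hops preserve it and move
the column labels in opposite directions. -/
theorem HopsRight.numRows_eq_and_colSum_lt (h : S.HopsRight T) :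
    T.numRows = S.numRows ∧ T.colSum < S.colSum := by
  obtain ⟨i, i', hi1, h, hi, hi', ⟨hz, r, hR, hnew⟩ | ⟨-, -, hA⟩ | ⟨hone, huniq, r, hR, hnew⟩⟩ := h
  · have hnum := hR.numRows_add
    rw [show T.south r = true from hnew.1, show S.south i = true from hi] at hnum
    refine ⟨by simpa using hnum, ?_⟩
    obtain ⟨-, hzero⟩ := zeroRow_of_corner_zero h hi hi' hz
    obtain ⟨D, hD⟩ := exists_isDeletion_zeroRow hi1 hzero
    have hT := hR.isDeletion hD
    have hcol := (hD.isCol_iff_of_le (k := ⟨i.val, by omega⟩) le_rfl h).1 hi'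
    rw [hD.rowLen_sub_one h hi'] at hnew
    obtain ⟨-, -, hc, he⟩ := hT.isNewRow_iff.1 hnew
    have hle : i'.val ≤ r.val := ((he.colsFrom_eq_iff (by omega)).1 hc).1.1
    exact colSum_lt_of_zeroRow hD hT hi hnew.1 hcol le_rfl (by simp; omega)
  · exact ⟨hA.numRows_eq.symm, hA.colSum_lt⟩
  · have hnum := hR.numRows_add
    rw [show T.south r = false from hnew.1, show S.south i' = false from hi'] at hnum
    refine ⟨by simpa using hnum, ?_⟩
    obtain ⟨D, hD⟩ := exists_isDeletion_col hi'
    have hT := hR.isDeletion hD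
    rw [hD.colLen_sub_one h hi] at hnew
    obtain ⟨j, rfl, hj, -, hl⟩ := hT.isNewCol_iff.1 hnew
    have hji : j.val < i.val := (hj.rowsBefore_eq_iff.1 hl).1.1
    have hrow := (hD.isRow_iff_of_lt (k := ⟨i.val, by omega⟩) (by simp; omega) rfl).1 hi
    -- The new column stands before row `i`, so row labels grow; all labels have a fixed total,
    -- hence `colSum` falls.
    have := rowSum_lt_of_col hD hT hi' hnew.1 hrow (by simp; omega) (by simp; omega)
    have h1 := S.rowSum_add_colSum
    have h2 := T.rowSum_add_colSum
    omega

theorem HopsLeft.numRows_eq_and_lt_colSum (h : S.HopsLeft T) :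
    T.numRows = S.numRows ∧ S.colSum < T.colSum := by
  obtain ⟨i, i', hA⟩ := h
  exact ⟨hA.numRows_eq, hA.colSum_lt⟩

end PermutationTableau

namespace PermChain

variable {N : ℕ}

/-! ### The number of moves -/

theorem IsNextNonexc.unique {n : ℕ} {π : Perm (Fin n)} {m k k' : ℕ} (h : IsNextNonexc π m k)
    (h' : IsNextNonexc π m k') : k = k' :=
  IsLeast.unique h h'

theorem EntersLeft.unique {π τ τ' : Perm (Fin (N + 1))} (h : EntersLeft π τ)
    (h' : EntersLeft π τ') : τ = τ' := by
  obtain ⟨p, hp, -, i, hi, rfl⟩ := h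
  obtain ⟨p', hp', -, i', hi', rfl⟩ := h'
  obtain rfl : p = p' := Fin.ext (by omega)
  obtain rfl : i = i' := by have := hi.unique hi'; omega
  rfl

theorem ExitsRight.unique {π τ τ' : Perm (Fin (N + 1))} (h : ExitsRight π τ)
    (h' : ExitsRight π τ') : τ = τ' := by
  obtain ⟨-, i, hi, h1, rfl⟩ := h
  obtain ⟨-, i', hi', h1', rfl⟩ := h'
  obtain rfl : i = i' := IsGreatest.unique h1 h1'
  rfl

/-- The moves `π → τ` that take place at position `c`, which is `0` for a particle that enters,
`N` for a particle that exits, and the position of the left one of the two sites for a hop. -/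
def MoveAt (π : Perm (Fin (N + 1))) (c : ℕ) (τ : Perm (Fin (N + 1))) : Prop :=
  (c = 0 ∧ EntersLeft π τ) ∨ (c = N ∧ ExitsRight π τ) ∨
  ∃ i i' : Fin (N + 1), c = i.val ∧ 1 ≤ i.val ∧ i'.val = i.val + 1 ∧
    ((i ≤ π i ∧ π i' < i' ∧
      ((π i = i ∧ ∃ m : ℕ, IsNextNonexc π (i'.val + 1) (m + 1) ∧ τ = collapseAddFixed π i m) ∨
       (i < π i ∧ π i' < i ∧ τ = π * swap i i') ∨
       (i < π i ∧ π i' = i ∧ ∃ (j : Fin (N + 1)) (h : j ≠ i'), IsPrevWeakExc π i j ∧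
         τ = collapseInsertBefore π i' j h))) ∨
     (π i < i ∧ i' ≤ π i' ∧ τ = π * swap i i'))

/-- Hops have `1 ≤ c < N`, so they share no position with entering (`0`) or exiting (`N`); at a
given hop position the conditions on `π` are mutually exclusive and determine the target. -/
theorem MoveAt.unique (hN : 1 ≤ N) {π τ τ' : Perm (Fin (N + 1))} {c : ℕ} (h : MoveAt π c τ)
    (h' : MoveAt π c τ') : τ = τ' := by
  rcases h with ⟨hc, h⟩ | ⟨hc, h⟩ | ⟨i, j, hc, hi, hj, h⟩ <;>
  rcases h' with ⟨hc', h'⟩ | ⟨hc', h'⟩ | ⟨i', j', hc', hi', hj', h'⟩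
  · exact h.unique h'
  · omega
  · omega
  · omega
  · exact h.unique h'
  · omega
  · omega
  · omega
  obtain rfl : i = i' := Fin.ext (by omega)
  obtain rfl : j = j' := Fin.ext (by omega)
  rcases h with ⟨h1, h2, h⟩ | ⟨h1, h2, rfl⟩ <;> rcases h' with ⟨h1', h2', h'⟩ | ⟨h1', h2', rfl⟩
  · rcases h with ⟨h3, m, hm, rfl⟩ | ⟨h3, h4, rfl⟩ | ⟨h3, h4, m, hmj, hm, rfl⟩ <;>
    rcases h' with ⟨h3', m', hm', rfl⟩ | ⟨h3', h4', rfl⟩ | ⟨h3', h4', m', hmj', hm', rfl⟩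
    · obtain rfl : m = m' := by have := hm.unique hm'; omega
      rfl
    · exact absurd h3 h3'.ne'
    · exact absurd h3 h3'.ne'
    · exact absurd h3' h3.ne'
    · rfl
    · exact absurd h4' h4.ne
    · exact absurd h3' h3.ne'
    · exact absurd h4 h4'.ne
    · obtain rfl : m = m' := IsGreatest.unique hm hm'
      rfl
  · exact absurd h1 h1'.not_ge
  · exact absurd h1' h1.not_ge
  · rfl

theorem exists_moveAt {π τ : Perm (Fin (N + 1))}
    (h : EntersLeft π τ ∨ HopsRight π τ ∨ ExitsRight π τ ∨ HopsLeft π τ) :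
    ∃ c : Fin (N + 1), MoveAt π c τ := by
  rcases h with h | ⟨i, i', h1, h2, h⟩ | h | ⟨i, i', h2, h⟩
  · exact ⟨0, Or.inl ⟨rfl, h⟩⟩
  · refine ⟨i, Or.inr (Or.inr ⟨i, i', rfl, by omega, h2, Or.inl ⟨h.1, h.2.1, h.2.2⟩⟩)⟩
  · exact ⟨Fin.last N, Or.inr (Or.inl ⟨rfl, h⟩)⟩
  · refine ⟨i, Or.inr (Or.inr ⟨i, i', rfl, ?_, h2, Or.inr h⟩)⟩
    have := Fin.lt_def.1 h.1
    omega

open Classical in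
theorem card_moves_le (hN : 1 ≤ N) (π : Perm (Fin (N + 1))) :
    (Finset.univ.filter fun τ => EntersLeft π τ ∨ HopsRight π τ ∨ ExitsRight π τ ∨
      HopsLeft π τ).card ≤ N + 1 := by
  have h : ∀ τ, ∃ c : Fin (N + 1), (EntersLeft π τ ∨ HopsRight π τ ∨ ExitsRight π τ ∨
      HopsLeft π τ) → MoveAt π c τ := fun τ => by
    by_cases hτ : EntersLeft π τ ∨ HopsRight π τ ∨ ExitsRight π τ ∨ HopsLeft π τ
    · obtain ⟨c, hc⟩ := exists_moveAt hτ
      exact ⟨c, fun _ => hc⟩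
    · exact ⟨0, fun h => absurd h hτ⟩
  choose f hf using h
  refine (Finset.card_le_card_of_injOn f (fun _ _ => Finset.mem_coe.2 (Finset.mem_univ _)) ?_).trans_eq
    (Finset.card_fin (N + 1))
  intro τ hτ τ' hτ' he
  have h1 := hf τ (Finset.mem_filter.1 hτ).2
  have h2 := hf τ' (Finset.mem_filter.1 hτ').2
  rw [← he] at h2
  exact h1.unique hN h2

end PermChain

/-! ### Transition probabilities and stochasticity -/

namespace PermutationTableau

variable {N : ℕ} {S T : PermutationTableau (N + 1)} {α β q : ℝ}

theorem moveProb_of_entersLeft (h : S.EntersLeft T) : moveProb α β q S T = α / (N + 1) :=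
  if_pos h

/-- The order of the branches in `moveProb` is immaterial, because `numRows` and `colSum` rule out
the other kinds. -/
theorem moveProb_of_hopsRight (h : S.HopsRight T) : moveProb α β q S T = 1 / (N + 1) := by
  have h1 := h.numRows_eq_and_colSum_lt
  rw [moveProb, if_neg fun h' => by have := h'.numRows_eq; omega, if_pos h]

theorem moveProb_of_exitsRight (h : S.ExitsRight T) : moveProb α β q S T = β / (N + 1) := by
  have h1 := h.numRows_eq
  rw [moveProb, if_neg fun h' => by have := h'.numRows_eq; omega,
    if_neg fun h' => by have := h'.numRows_eq_and_colSum_lt; omega, if_pos h]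

theorem moveProb_of_hopsLeft (h : S.HopsLeft T) : moveProb α β q S T = q / (N + 1) := by
  have h1 := h.numRows_eq_and_lt_colSum
  rw [moveProb, if_neg fun h' => by have := h'.numRows_eq; omega,
    if_neg fun h' => by have := h'.numRows_eq_and_colSum_lt; omega,
    if_neg fun h' => by have := h'.numRows_eq; omega, if_pos h]

theorem moveProb_eq_zero (h1 : ¬ S.EntersLeft T) (h2 : ¬ S.HopsRight T) (h3 : ¬ S.ExitsRight T)
    (h4 : ¬ S.HopsLeft T) : moveProb α β q S T = 0 := by
  rw [moveProb, if_neg h1, if_neg h2, if_neg h3, if_neg h4]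

theorem ne_of_move (h : S.EntersLeft T ∨ S.HopsRight T ∨ S.ExitsRight T ∨ S.HopsLeft T) :
    S ≠ T := by
  rintro rfl
  rcases h with h | h | h | h
  · have := h.numRows_eq; omega
  · have := h.numRows_eq_and_colSum_lt; omega
  · have := h.numRows_eq; omega
  · have := h.numRows_eq_and_lt_colSum; omega

theorem moveProb_nonneg (hα : 0 ≤ α) (hβ : 0 ≤ β) (hq : 0 ≤ q) : 0 ≤ moveProb α β q S T := by
  rw [moveProb]
  split_ifs <;> positivity

open Classical in
theorem moveProb_le (hα : α ≤ 1) (hβ : β ≤ 1) (hq : q ≤ 1) : moveProb α β q S T ≤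
    if S.EntersLeft T ∨ S.HopsRight T ∨ S.ExitsRight T ∨ S.HopsLeft T then 1 / ((N : ℝ) + 1)
    else 0 := by
  have key : ∀ x : ℝ, x ≤ 1 → x / ((N : ℝ) + 1) ≤ 1 / ((N : ℝ) + 1) := fun x hx => by gcongr
  by_cases h1 : S.EntersLeft T
  · rw [moveProb_of_entersLeft h1, if_pos (Or.inl h1)]; exact key _ hα
  by_cases h2 : S.HopsRight T
  · rw [moveProb_of_hopsRight h2, if_pos (Or.inr (Or.inl h2))]
  by_cases h3 : S.ExitsRight T
  · rw [moveProb_of_exitsRight h3, if_pos (Or.inr (Or.inr (Or.inl h3)))]; exact key _ hβ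
  by_cases h4 : S.HopsLeft T
  · rw [moveProb_of_hopsLeft h4, if_pos (Or.inr (Or.inr (Or.inr h4)))]; exact key _ hq
  · rw [moveProb_eq_zero h1 h2 h3 h4, if_neg (by tauto)]

open Classical in
theorem card_moves_le (hN : 1 ≤ N) (S : PermutationTableau (N + 1)) :
    (Finset.univ.filter fun T => S.EntersLeft T ∨ S.HopsRight T ∨ S.ExitsRight T ∨
      S.HopsLeft T).card ≤ N + 1 := by
  refine le_trans ?_ (PermChain.card_moves_le hN S.phi)
  refine Finset.card_le_card_of_injOn phi (fun T hT => ?_) phi_injective.injOn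
  have := (Finset.mem_filter.1 hT).2
  rw [entersLeft_iff hN, hopsRight_iff, exitsRight_iff hN, hopsLeft_iff] at this
  exact Finset.mem_coe.2 (Finset.mem_filter.2 ⟨Finset.mem_univ _, this⟩)

-- At most `N + 1` targets are reached by moves, each with probability at most `1 / (N + 1)`; this
-- makes the diagonal entries nonnegative.
open Classical in
theorem sum_moveProb_le (hN : 1 ≤ N) (hα : 0 ≤ α) (hα' : α ≤ 1) (hβ : 0 ≤ β) (hβ' : β ≤ 1)
    (hq : 0 ≤ q) (hq' : q ≤ 1) (S : PermutationTableau (N + 1)) :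
    ∑ T ∈ Finset.univ.erase S, moveProb α β q S T ≤ 1 := by
  have hpos : (0 : ℝ) < (N : ℝ) + 1 := by positivity
  calc ∑ T ∈ Finset.univ.erase S, moveProb α β q S T
      ≤ ∑ T, moveProb α β q S T :=
        Finset.sum_le_sum_of_subset_of_nonneg (Finset.erase_subset _ _)
          fun T _ _ => moveProb_nonneg hα hβ hq
    _ ≤ ∑ T, if S.EntersLeft T ∨ S.HopsRight T ∨ S.ExitsRight T ∨ S.HopsLeft T
          then 1 / ((N : ℝ) + 1) else 0 := Finset.sum_le_sum fun T _ => moveProb_le hα' hβ' hq'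
    _ = (Finset.univ.filter fun T => S.EntersLeft T ∨ S.HopsRight T ∨ S.ExitsRight T ∨
          S.HopsLeft T).card * (1 / ((N : ℝ) + 1)) := by
        rw [← Finset.sum_filter, Finset.sum_const, nsmul_eq_mul]
    _ ≤ ((N : ℝ) + 1) * (1 / ((N : ℝ) + 1)) := by
        gcongr
        exact_mod_cast card_moves_le hN S
    _ = 1 := by field_simp

theorem ptChain_of_ne (h : S ≠ T) : ptChain N α β q S T = moveProb α β q S T := by
  rw [ptChain, Matrix.of_apply, if_neg h]

/-- The decidability instance is arbitrary, whereas the definition of `ptChain` uses the classical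
one. -/
theorem ptChain_self [DecidableEq (PermutationTableau (N + 1))] (S : PermutationTableau (N + 1)) :
    ptChain N α β q S S = 1 - ∑ T ∈ Finset.univ.erase S, ptChain N α β q S T := by
  classical
  rw [ptChain, Matrix.of_apply, if_pos rfl]
  congr 1
  refine Finset.sum_congr (by congr!) fun T hT => ?_
  exact (ptChain_of_ne (Finset.ne_of_mem_erase hT).symm).symm

theorem ptChain_nonneg (hN : 1 ≤ N) (hα : 0 ≤ α) (hα' : α ≤ 1) (hβ : 0 ≤ β) (hβ' : β ≤ 1)
    (hq : 0 ≤ q) (hq' : q ≤ 1) (S T : PermutationTableau (N + 1)) : 0 ≤ ptChain N α β q S T := by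
  classical
  by_cases h : S = T
  · rw [ptChain, Matrix.of_apply, if_pos h, sub_nonneg]
    convert sum_moveProb_le hN hα hα' hβ hβ' hq hq' S
  · rw [ptChain_of_ne h]
    exact moveProb_nonneg hα hβ hq

end PermutationTableau

/-- There is a bijection `Φ` from the permutation tableaux of half-perimeter `N + 1` to `S_{N+1}`,
given by the zig-zag paths, and under it the PT chain becomes the Markov chain on `S_{N+1}` whose
transitions, with their probabilities, are the four kinds of moves on permutations. -/
theorem proposition6p2 (N : ℕ) (hN : 1 ≤ N) :
    ∃ Φ : PermutationTableau (N + 1) ≃ Equiv.Perm (Fin (N + 1)),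
      (∀ (T : PermutationTableau (N + 1)) (x : Fin (N + 1)), T.ZigzagEnd x (Φ T x)) ∧
      ∀ α β q : ℝ, ∀ P : Matrix (Equiv.Perm (Fin (N + 1))) (Equiv.Perm (Fin (N + 1))) ℝ,
        P = Matrix.reindex Φ Φ (PermutationTableau.ptChain N α β q) →
        (∀ π τ, PermChain.EntersLeft π τ → P π τ = α / (N + 1)) ∧
        (∀ π τ, PermChain.HopsRight π τ → P π τ = 1 / (N + 1)) ∧
        (∀ π τ, PermChain.ExitsRight π τ → P π τ = β / (N + 1)) ∧
        (∀ π τ, PermChain.HopsLeft π τ → P π τ = q / (N + 1)) ∧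
        (∀ π τ, π ≠ τ → ¬ PermChain.EntersLeft π τ → ¬ PermChain.HopsRight π τ →
          ¬ PermChain.ExitsRight π τ → ¬ PermChain.HopsLeft π τ → P π τ = 0) ∧
        (∀ π, P π π = 1 - ∑ τ ∈ Finset.univ.erase π, P π τ) ∧
        (0 ≤ α → α ≤ 1 → 0 ≤ β → β ≤ 1 → 0 ≤ q → q ≤ 1 →
          P ∈ Matrix.rowStochastic ℝ (Equiv.Perm (Fin (N + 1)))) := by
  classical
  refine ⟨PermutationTableau.phiEquiv (N + 1), fun T x => T.zigzagEnd_phi x, ?_⟩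
  rintro α β q P rfl
  have hP : ∀ S T : PermutationTableau (N + 1),
      Matrix.reindex (PermutationTableau.phiEquiv (N + 1)) (PermutationTableau.phiEquiv (N + 1))
        (PermutationTableau.ptChain N α β q) S.phi T.phi = PermutationTableau.ptChain N α β q S T :=
    fun S T => by
      rw [Matrix.reindex_apply, Matrix.submatrix_apply, ← PermutationTableau.phiEquiv_apply,
        ← PermutationTableau.phiEquiv_apply, Equiv.symm_apply_apply, Equiv.symm_apply_apply]
  set P := Matrix.reindex (PermutationTableau.phiEquiv (N + 1))
    (PermutationTableau.phiEquiv (N + 1)) (PermutationTableau.ptChain N α β q)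
  have hsurj : ∀ π : Equiv.Perm (Fin (N + 1)), ∃ S : PermutationTableau (N + 1), S.phi = π :=
    PermutationTableau.exists_phi_eq (N + 1)
  have hself : ∀ π, P π π = 1 - ∑ τ ∈ Finset.univ.erase π, P π τ := by
    intro π
    obtain ⟨S, rfl⟩ := hsurj π
    rw [hP, PermutationTableau.ptChain_self]
    congr 1
    -- The diagonal formula is transported by reindexing the sum along the bijection.
    refine Finset.sum_equiv (PermutationTableau.phiEquiv (N + 1)) (fun T => ?_) fun T _ => ?_
    · simp [PermutationTableau.phiEquiv_apply, PermutationTableau.phi_injective.eq_iff]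
    · rw [PermutationTableau.phiEquiv_apply, hP]
  refine ⟨fun π τ h => ?_, fun π τ h => ?_, fun π τ h => ?_, fun π τ h => ?_,
    fun π τ hne h1 h2 h3 h4 => ?_, hself, fun hα hα' hβ hβ' hq hq' => ?_⟩
  · obtain ⟨S, rfl⟩ := hsurj π
    obtain ⟨T, rfl⟩ := hsurj τ
    rw [← PermutationTableau.entersLeft_iff hN] at h
    rw [hP, PermutationTableau.ptChain_of_ne (PermutationTableau.ne_of_move (by tauto)),
      PermutationTableau.moveProb_of_entersLeft h]
  · obtain ⟨S, rfl⟩ := hsurj π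
    obtain ⟨T, rfl⟩ := hsurj τ
    rw [← PermutationTableau.hopsRight_iff] at h
    rw [hP, PermutationTableau.ptChain_of_ne (PermutationTableau.ne_of_move (by tauto)),
      PermutationTableau.moveProb_of_hopsRight h]
  · obtain ⟨S, rfl⟩ := hsurj π
    obtain ⟨T, rfl⟩ := hsurj τ
    rw [← PermutationTableau.exitsRight_iff hN] at h
    rw [hP, PermutationTableau.ptChain_of_ne (PermutationTableau.ne_of_move (by tauto)),
      PermutationTableau.moveProb_of_exitsRight h]
  · obtain ⟨S, rfl⟩ := hsurj π
    obtain ⟨T, rfl⟩ := hsurj τ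
    rw [← PermutationTableau.hopsLeft_iff] at h
    rw [hP, PermutationTableau.ptChain_of_ne (PermutationTableau.ne_of_move (by tauto)),
      PermutationTableau.moveProb_of_hopsLeft h]
  · obtain ⟨S, rfl⟩ := hsurj π
    obtain ⟨T, rfl⟩ := hsurj τ
    rw [← PermutationTableau.entersLeft_iff hN] at h1
    rw [← PermutationTableau.hopsRight_iff] at h2
    rw [← PermutationTableau.exitsRight_iff hN] at h3
    rw [← PermutationTableau.hopsLeft_iff] at h4
    rw [hP, PermutationTableau.ptChain_of_ne fun e => hne (congrArg _ e),
      PermutationTableau.moveProb_eq_zero h1 h2 h3 h4]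
  · rw [Matrix.mem_rowStochastic_iff_sum]
    refine ⟨fun π τ => ?_, fun π => ?_⟩
    · obtain ⟨S, rfl⟩ := hsurj π
      obtain ⟨T, rfl⟩ := hsurj τ
      rw [hP]
      exact PermutationTableau.ptChain_nonneg hN hα hα' hβ hβ' hq hq' S T
    · rw [← Finset.add_sum_erase _ _ (Finset.mem_univ π), hself]
      ring
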